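/- \textbf{Lemma.} Let $E^1(2)$ be the space of real symmetric $2$-tensors on $\mathbb{R}^2$, and $E^2(2)$ the space of real $4$-tensors $w_{ijk\ell}$ on $\mathbb{R}^2$ with $w_{ijk\ell}=w_{jik\ell}=w_{ij\ell k}=w_{k\ell ij}$; sections of these are called elastic $1$- and $2$-tensor fields. For smooth vector fields $u$, smooth elastic $1$-tensor fields $v$ and smooth elastic $2$-tensor fields $w$ put \[ (Ku)_{ijk\ell}=\tfrac14(\partial_iu_j+\partial_ju_i)\delta_{k\ell}+\tfrac14(\partial_ku_\ell+\partial_\ell u_k)\delta_{ij},\qquad (Hv)_{ijk\ell}=\tfrac12(\partial_i\partial_jv_{k\ell}+\partial_k\partial_\ell v_{ij}), \] with formal $L^2$-adjoints \[ (K^*w)_i=-\sum_{j,k}\partial_jw_{ijkk},\qquad (H^*w)_{ij}=\sum_{k,\ell}\partial_k\partial_\ell w_{ijk\ell}. \] Let $\mathcal{A}_2$ be the set of elastic $2$-tensor fields $w\in C^\infty\cap L^2$ on $\mathbb{R}^2$ such that $|w(x)|\le C(1+|x|)^{-1}$ for some $C$ and all $x$, and such that the Fourier transform $\widehat w$ is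 smooth on $\mathbb{R}^2\setminus\{0\}$ and rapidly decreasing (for every $N$, $|y|^N|\widehat w(y)|$ is bounded on $|y|\ge1$). Let $\mathcal{A}_0^K$ be the set of smooth vector fields $u$ with $Ku\in\mathcal{A}_2$, and $\mathcal{A}_1^H$ the set of smooth elastic $1$-tensor fields $v$ with $Hv\in\mathcal{A}_2$. Let $f\in\mathcal{S}(E^2(2))$ be an elastic $2$-tensor field with Schwartz components satisfying $\int_{\mathbb{R}^2}f_{ijk\ell}\,dx=0$ for all $i,j,k,\ell$. Then there is exactly one pair $(h,g)$ of tensor fields $h,g\in\mathcal{A}_2$ such that \[ f=h+g,\qquad H^*g=0,\qquad K^*g=0, \] and such that $h$ is potential, that is, $h=Ku+Hv$ for some vector field $u\in\mathcal{A}_0^K$ and some elastic $1$-tensor field $v\in\mathcal{A}_1^H$. -/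

import Mathlib

open MeasureTheory FourierTransform
open scoped SchwartzMap ContDiff ENNReal

noncomputable section

namespace ElasticTensor

/-- The Euclidean space `ℝⁿ`. -/
abbrev Space (n : ℕ) := EuclideanSpace ℝ (Fin n)

/-- Vector fields on `ℝⁿ`, in Cartesian components. -/
abbrev VectorField (n : ℕ) := Space n → Fin n → ℝ

/-- `2`-tensor fields on `ℝⁿ`, in Cartesian components. -/
abbrev TensorField2 (n : ℕ) := Space n → Fin n → Fin n → ℝ

/-- `4`-tensor fields on `ℝⁿ`, in Cartesian components. -/
abbrev TensorField4 (n : ℕ) := Space n → Fin n → Fin n → Fin n → Fin n → ℝ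

/-- The partial derivative `∂w/∂xᵢ`. -/
def pderiv {n : ℕ} (i : Fin n) (w : Space n → ℝ) (x : Space n) : ℝ :=
  fderiv ℝ w x (EuclideanSpace.single i 1)

/-- The Kronecker symbol. -/
def kron {n : ℕ} (i j : Fin n) : ℝ := if i = j then 1 else 0

/-- `v` takes values in `E¹(n) = S²(ℝⁿ)`, the symmetric `2`-tensors. -/
def IsElastic1 {n : ℕ} (v : TensorField2 n) : Prop :=
  ∀ x i j, v x i j = v x j i

/-- `w` takes values in `E²(n)`: the `4`-tensors that are symmetric in the first two indices,
symmetric in the last two indices, and invariant under exchanging the two pairs. -/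
def IsElastic2 {n : ℕ} (w : TensorField4 n) : Prop :=
  ∀ x i j k l, w x i j k l = w x j i k l ∧ w x i j k l = w x i j l k ∧
    w x i j k l = w x k l i j

/-- `f ∈ 𝓢(E²(n))`: an elastic `2`-tensor field all of whose components are Schwartz functions. -/
def IsSchwartzElastic2 {n : ℕ} (f : TensorField4 n) : Prop :=
  IsElastic2 f ∧ ∀ i j k l, ∃ φ : 𝓢(Space n, ℝ), ∀ x, φ x = f x i j k l

/-- The operator `H` from elastic `1`-tensor fields to elastic `2`-tensor fields:
`(Hv)ᵢⱼₖₗ = ½ (∂ᵢ∂ⱼ vₖₗ + ∂ₖ∂ₗ vᵢⱼ)`. -/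
def opH {n : ℕ} (v : TensorField2 n) : TensorField4 n := fun x i j k l =>
  (1 / 2) * (pderiv i (pderiv j (fun z => v z k l)) x +
    pderiv k (pderiv l (fun z => v z i j)) x)

/-- The formal `L²`-adjoint of `H`: `(H*w)ᵢⱼ = ∑ₖₗ ∂ₖ∂ₗ wᵢⱼₖₗ`. -/
def opHstar {n : ℕ} (w : TensorField4 n) : TensorField2 n := fun x i j =>
  ∑ k, ∑ l, pderiv k (pderiv l (fun z => w z i j k l)) x

/-- The operator `K` from vector fields to elastic `2`-tensor fields:
`(Ku)ᵢⱼₖₗ = ¼ (∂ᵢuⱼ + ∂ⱼuᵢ) δₖₗ + ¼ (∂ₗuₖ + ∂ₖuₗ) δᵢⱼ`. -/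
def opK {n : ℕ} (u : VectorField n) : TensorField4 n := fun x i j k l =>
  (1 / 4) * (pderiv i (fun z => u z j) x + pderiv j (fun z => u z i) x) * kron k l +
    (1 / 4) * (pderiv l (fun z => u z k) x + pderiv k (fun z => u z l) x) * kron i j

/-- The formal `L²`-adjoint of `K`: `(K*w)ᵢ = - ∑ₖⱼ ∂ⱼ wᵢⱼₖₖ`. -/
def opKstar {n : ℕ} (w : TensorField4 n) : VectorField n := fun x i =>
  - ∑ k, ∑ j, pderiv j (fun z => w z i j k k) x

/-- `φ ∈ L²(ℝⁿ)` and its (Plancherel) Fourier transform is, as an `L²` class, represented by a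
function that is smooth away from `0` and rapidly decreasing. -/
def HasNiceFourier {n : ℕ} (φ : Space n → ℝ) : Prop :=
  ∃ hφ : MemLp (fun x => (φ x : ℂ)) 2 volume, ∃ F : Space n → ℂ,
    ⇑(𝓕 (hφ.toLp (fun x => (φ x : ℂ))) : Lp ℂ 2 (volume : Measure (Space n))) =ᵐ[volume] F ∧
    ContDiffOn ℝ ∞ F {0}ᶜ ∧
    ∀ N : ℕ, ∃ C : ℝ, ∀ y, 1 ≤ ‖y‖ → ‖y‖ ^ N * ‖F y‖ ≤ C

/-- The class `𝒜₂` of elastic `2`-tensor fields on `ℝⁿ` that are smooth and square integrable,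
satisfy `|f(x)| ≤ C (1 + |x|)^(1 - n)`, and whose Fourier transform is smooth away from `0` and
rapidly decreasing. -/
structure MemA2 {n : ℕ} (f : TensorField4 n) : Prop where
  elastic : IsElastic2 f
  smooth : ∀ i j k l, ContDiff ℝ ∞ (fun x => f x i j k l)
  memL2 : ∀ i j k l, MemLp (fun x => f x i j k l) 2 volume
  decay : ∃ C : ℝ, ∀ x i j k l, |f x i j k l| ≤ C * (1 + ‖x‖) ^ (1 - (n : ℤ))
  fourier : ∀ i j k l, HasNiceFourier (fun x => f x i j k l)

/-- The space `𝒜₁ᴴ` of smooth elastic `1`-tensor fields `v` with `Hv ∈ 𝒜₂`. -/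
structure MemA1H {n : ℕ} (v : TensorField2 n) : Prop where
  elastic : IsElastic1 v
  smooth : ∀ i j, ContDiff ℝ ∞ (fun x => v x i j)
  image : MemA2 (opH v)

/-- The space `𝒜₀ᴷ` of smooth vector fields `u` with `Ku ∈ 𝒜₂`. -/
structure MemA0K {n : ℕ} (u : VectorField n) : Prop where
  smooth : ∀ i, ContDiff ℝ ∞ (fun x => u x i)
  image : MemA2 (opK u)

end ElasticTensor

end

/-! On the Fourier side the problem is linear algebra at each frequency `y ≠ 0`. Differentiation
`∂ᵢ` becomes multiplication by `2π|y| ρᵢ`, where `ρ = riesz` is `i y/|y|`. With the rotated vector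
`ρ⊥ = rieszPerp`, the products `ρρ`, `ρρ⊥` (symmetrized), `ρ⊥ρ⊥` form an orthogonal frame of the
symmetric tensors, so an elastic `2`-tensor is a symmetric `3 × 3` matrix `c` of frame coefficients.

`H*g = 0` says that the entries `c₀₀, c₁₀, c₂₀` vanish. Given this, the `ρ⊥` component of `K*g = 0`
says that `c₁₂` vanishes. Potential fields are exactly complementary: they satisfy `c₁₁ = c₂₂ = 0`.
Hence the solenoidal part keeps `c₁₁` and `c₂₂`, and the other four entries are produced by explicit
potentials (`symbol_decomposition`).

Uniqueness: a difference of two solenoidal parts is also a difference of potential parts, so all its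
coefficients vanish almost everywhere. The potentials themselves have no growth bound and need not
have a Fourier transform. The conditions `c₁₁ = c₂₂ = 0` are therefore derived from fourth-order
differential identities for arbitrary smooth potentials, and only the potential field is then
transformed (`frameCoeff_eq_zero_of_potential`).

Existence: all symbols are products of Fourier transforms of components of `f` with functions
homogeneous of degree zero. The mean-zero hypothesis makes these transforms vanish at the origin. So
the products stay Lipschitz there, which yields the decay `1/(1+|x|)` (`IsSymbol.riesz_mul`,
`IsSymbol.norm_fourierInv_le`), and division by `|y|²` still leaves an integrable function on the
plane (`IsSymbol.hasMoments_inv_norm_sq`), so the potentials exist as convergent integrals. -/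

namespace ElasticTensor

/-! ### Inverse Fourier transforms of functions with finite moments. -/

/-- A function on `ℝⁿ` all of whose absolute moments are finite. -/
structure HasMoments {n : ℕ} (F : Space n → ℂ) : Prop where
  aestronglyMeasurable : AEStronglyMeasurable F volume
  integrable_moment : ∀ N : ℕ, Integrable (fun y => ‖y‖ ^ N * ‖F y‖) volume

/-- `φ` is the inverse Fourier transform of a function with finite moments. -/
def IsInvFourier {n : ℕ} (φ : Space n → ℝ) (F : Space n → ℂ) : Prop :=
  HasMoments F ∧ ∀ x, (φ x : ℂ) = 𝓕⁻ F x

namespace HasMoments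

variable {n : ℕ} {F G : Space n → ℂ}

lemma integrable (hF : HasMoments F) : Integrable F := by
  have := hF.integrable_moment 0
  simp only [pow_zero, one_mul] at this
  exact (integrable_norm_iff hF.aestronglyMeasurable).1 this

lemma zero : HasMoments (fun _ : Space n => (0 : ℂ)) :=
  ⟨aestronglyMeasurable_const, fun N => by simp⟩

lemma of_norm_le (hF : HasMoments F) (hG : AEStronglyMeasurable G volume)
    (h : ∀ᵐ y, ‖G y‖ ≤ ‖F y‖) : HasMoments G := by
  refine ⟨hG, fun N => (hF.integrable_moment N).mono' (by fun_prop) ?_⟩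
  filter_upwards [h] with y hy
  rw [Real.norm_of_nonneg (by positivity)]
  gcongr

lemma congr_ae (hF : HasMoments F) (h : F =ᵐ[volume] G) : HasMoments G :=
  hF.of_norm_le (hF.aestronglyMeasurable.congr h) (by filter_upwards [h] with y hy; rw [hy])

lemma add (hF : HasMoments F) (hG : HasMoments G) : HasMoments (fun y => F y + G y) := by
  refine ⟨hF.1.add hG.1, fun N => ((hF.2 N).add (hG.2 N)).mono' ?_ ?_⟩
  · have := hF.1
    have := hG.1
    fun_prop
  · filter_upwards with y
    rw [Real.norm_of_nonneg (by positivity), Pi.add_apply, ← mul_add]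
    gcongr
    exact norm_add_le _ _

lemma const_mul (c : ℂ) (hF : HasMoments F) : HasMoments (fun y => c * F y) := by
  refine ⟨hF.1.const_mul c, fun N => ((hF.2 N).const_mul ‖c‖).congr ?_⟩
  filter_upwards with y
  rw [norm_mul]
  ring

lemma coord_mul (i : Fin n) (hF : HasMoments F) :
    HasMoments (fun y => ((y i : ℝ) : ℂ) * F y) := by
  have h1 := hF.1
  have hm : AEStronglyMeasurable (fun y : Space n => ((y i : ℝ) : ℂ) * F y) volume :=
    (by fun_prop : Continuous fun y : Space n => ((y i : ℝ) : ℂ)).aestronglyMeasurable.mul h1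
  refine ⟨hm, fun N => (hF.2 (N + 1)).mono' (by fun_prop) ?_⟩
  filter_upwards with y
  rw [Real.norm_of_nonneg (by positivity), norm_mul, pow_succ, mul_assoc]
  gcongr
  simpa using PiLp.norm_apply_le y i

end HasMoments

section fourierInv

variable {n : ℕ} {F G : Space n → ℂ}

lemma fourierInv_add_apply (hF : Integrable F) (hG : Integrable G) (x : Space n) :
    𝓕⁻ (fun y => F y + G y) x = 𝓕⁻ F x + 𝓕⁻ G x := by
  have key : ∀ {f : Space n → ℂ}, Integrable f →
      Integrable (fun v => Real.fourierChar (inner ℝ v x) • f v) := fun {f} hf => by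
    have := (Real.fourierIntegral_convergent_iff (-x)).2 hf
    simpa using this
  simp only [Real.fourierInv_eq, smul_add]
  exact integral_add (key hF) (key hG)

lemma fourierInv_const_mul_apply (c : ℂ) (F : Space n → ℂ) (x : Space n) :
    𝓕⁻ (fun y => c * F y) x = c * 𝓕⁻ F x := by
  simp only [Real.fourierInv_eq, ← integral_const_mul, mul_smul_comm]

lemma contDiff_fourierInv (hF : HasMoments F) : ContDiff ℝ ∞ (𝓕⁻ F) := by
  have h : ContDiff ℝ ∞ (𝓕 F) := Real.contDiff_fourier (N := ⊤) fun k _ => hF.2 k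
  have : 𝓕⁻ F = fun x => 𝓕 F (-x) := by
    ext x; exact Real.fourierInv_eq_fourier_neg F x
  rw [this]
  exact h.comp contDiff_neg

lemma fderiv_fourierInv_apply (hF : HasMoments F) (x : Space n) (i : Fin n) :
    fderiv ℝ (𝓕⁻ F) x (EuclideanSpace.single i 1) =
      𝓕⁻ (fun y => 2 * Real.pi * Complex.I * (y i : ℂ) * F y) x := by
  have h1 : Integrable (fun v => ‖v‖ * ‖F v‖) := by simpa using hF.2 1
  have h2 : HasFDerivAt (𝓕⁻ F) _ x :=
    (((Real.hasFDerivAt_fourier hF.integrable h1 (-x)).comp x (hasFDerivAt_id x).neg).congr_of_eventuallyEq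
      (Filter.Eventually.of_forall fun z => Real.fourierInv_eq_fourier_neg F z))
  rw [h2.fderiv]
  simp only [ContinuousLinearMap.comp_apply, neg_apply,
    ContinuousLinearMap.id_apply, map_neg]
  have h3 : Integrable (VectorFourier.fourierSMulRight (innerSL ℝ) F) := by
    refine (h1.const_mul (2 * Real.pi * ‖innerSL ℝ (E := Space n)‖)).mono'
      (hF.1.fourierSMulRight) ?_
    filter_upwards with v
    refine (VectorFourier.norm_fourierSMulRight_le _ _ _).trans (le_of_eq (by ring))
  rw [Real.fourier_continuousLinearMap_apply h3, ← Real.fourierInv_eq_fourier_neg]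
  have : (fun y : Space n => 2 * Real.pi * Complex.I * (y i : ℂ) * F y) =
      fun y => (-1) * (VectorFourier.fourierSMulRight (innerSL ℝ) F y
        (EuclideanSpace.single i 1)) := by
    ext y
    have e : innerSL ℝ y (EuclideanSpace.single i (1 : ℝ)) = y i := by
      change inner ℝ y _ = _
      simp [EuclideanSpace.inner_single_right]
    rw [VectorFourier.fourierSMulRight_apply, e, Complex.real_smul, smul_eq_mul]
    ring
  rw [this, fourierInv_const_mul_apply]
  ring

/-- The integral Fourier inverse and the `L²` Fourier inverse agree on `L¹ ∩ L²`. -/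
lemma coeFn_fourierInv_toLp (hF : Integrable F) (hF2 : MemLp F 2 volume) :
    ⇑(𝓕⁻ (hF2.toLp F) : Lp ℂ 2 (volume : Measure (Space n))) =ᵐ[volume] 𝓕⁻ F := by
  have hcont : Continuous (𝓕⁻ F) := by
    have h : Continuous (𝓕 F) := VectorFourier.fourierIntegral_continuous
      Real.continuous_fourierChar (innerSL ℝ).continuous₂ hF
    have e : 𝓕⁻ F = fun x => 𝓕 F (-x) := by
      ext x; exact Real.fourierInv_eq_fourier_neg F x
    rw [e]; fun_prop
  refine ae_eq_of_integral_contDiff_smul_eq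
    ((Lp.memLp _).locallyIntegrable (by norm_num)) hcont.locallyIntegrable ?_
  -- Both sides are tested against a real test function: the `L²` transform is dual to the Schwartz
  -- one through tempered distributions, the integral transform through Fubini.
  intro g hg hgc
  let ψ : 𝓢(Space n, ℂ) := (hgc.comp_left (g := Complex.ofReal) (by simp)).toSchwartzMap
    (Complex.ofRealCLM.contDiff.comp hg)
  have hψ : ∀ x, ψ x = (g x : ℂ) := fun x => rfl
  have h1 := DFunLike.congr_fun (Lp.fourierInv_toTemperedDistribution_eq (hF2.toLp F)) ψ
  rw [TemperedDistribution.fourierInv_apply, Lp.toTemperedDistribution_apply,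
    Lp.toTemperedDistribution_apply] at h1
  simp only [hψ, smul_eq_mul] at h1
  simp only [Complex.real_smul]
  rw [← h1]
  have h2 : ∫ x, (𝓕⁻ ψ) x * (hF2.toLp F) x = ∫ x, (𝓕⁻ ψ) x * F x :=
    integral_congr_ae (by filter_upwards [hF2.coeFn_toLp] with x hx; rw [hx])
  rw [h2, SchwartzMap.fourierInv_coe]
  -- The pairing `-inner` turns the general Fourier integral into the inverse transform.
  have h3 := VectorFourier.integral_fourierIntegral_smul_eq_flip (μ := volume) (ν := volume)
    (L := -innerₗ (Space n)) (f := ⇑ψ) (g := F) (e := Real.fourierChar)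
    Real.continuous_fourierChar (by
      have : Continuous fun p : Space n × Space n => -(inner ℝ p.1 p.2) := by fun_prop
      exact this) ψ.integrable hF
  have h4 : (-innerₗ (Space n)).flip = -innerₗ (Space n) := by
    ext x y; simp [real_inner_comm]
  rw [h4] at h3
  exact h3

/-- Every test function is `𝓕⁻ (𝓕 ψ)`, and the outer `𝓕⁻` can be moved onto `F`, where it vanishes.
This makes the frequency side of `IsInvFourier` unique almost everywhere. -/
lemma ae_eq_zero_of_fourierInv_eq_zero (hF : Integrable F) (h : ∀ x, 𝓕⁻ F x = 0) :
    F =ᵐ[volume] 0 := by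
  refine ae_eq_zero_of_integral_contDiff_smul_eq_zero hF.locallyIntegrable ?_
  intro g hg hgc
  let ψ : 𝓢(Space n, ℂ) := (hgc.comp_left (g := Complex.ofReal) (by simp)).toSchwartzMap
    (Complex.ofRealCLM.contDiff.comp hg)
  have hψ : ∀ x, (𝓕⁻ (𝓕 ψ)) x = (g x : ℂ) := fun x => by
    rw [FourierTransform.fourierInv_fourier_eq]; rfl
  have h3 := VectorFourier.integral_fourierIntegral_smul_eq_flip (μ := volume) (ν := volume)
    (L := -innerₗ (Space n)) (f := ⇑(𝓕 ψ : 𝓢(Space n, ℂ))) (g := F) (e := Real.fourierChar)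
    Real.continuous_fourierChar (by
      have : Continuous fun p : Space n × Space n => -(inner ℝ p.1 p.2) := by fun_prop
      exact this) (𝓕 ψ : 𝓢(Space n, ℂ)).integrable hF
  have h4 : (-innerₗ (Space n)).flip = -innerₗ (Space n) := by
    ext x y; simp [real_inner_comm]
  rw [h4] at h3
  have h5 : ∀ x, VectorFourier.fourierIntegral Real.fourierChar volume (-innerₗ (Space n)) F x = 0 := h
  simp only [h5, smul_zero, integral_zero] at h3
  rw [← h3]
  refine integral_congr_ae (Filter.Eventually.of_forall fun x => ?_)
  simp only [Complex.real_smul, smul_eq_mul, ← hψ, SchwartzMap.fourierInv_coe]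
  rfl

end fourierInv

namespace IsInvFourier

variable {n : ℕ} {φ ψ : Space n → ℝ} {F G : Space n → ℂ}

lemma congr_ae (h : IsInvFourier φ F) (hFG : F =ᵐ[volume] G) : IsInvFourier φ G :=
  ⟨h.1.congr_ae hFG, fun x => by rw [h.2, Real.fourierInv_congr_ae hFG]⟩

lemma congr (h : IsInvFourier φ F) (hφ : ∀ x, φ x = ψ x) (hFG : ∀ y, F y = G y) :
    IsInvFourier ψ G := by
  obtain rfl : φ = ψ := funext hφ
  obtain rfl : F = G := funext hFG
  exact h

lemma zero : IsInvFourier (fun _ : Space n => 0) (fun _ => 0) :=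
  ⟨HasMoments.zero, fun x => by simp [Real.fourierInv_eq]⟩

lemma add (h : IsInvFourier φ F) (h' : IsInvFourier ψ G) :
    IsInvFourier (fun x => φ x + ψ x) (fun y => F y + G y) :=
  ⟨h.1.add h'.1, fun x => by
    rw [fourierInv_add_apply h.1.integrable h'.1.integrable, Complex.ofReal_add, h.2, h'.2]⟩

lemma const_mul (c : ℝ) (h : IsInvFourier φ F) :
    IsInvFourier (fun x => c * φ x) (fun y => c * F y) :=
  ⟨h.1.const_mul c, fun x => by
    rw [fourierInv_const_mul_apply, Complex.ofReal_mul, h.2]⟩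

lemma mul_const (c : ℝ) (h : IsInvFourier φ F) :
    IsInvFourier (fun x => φ x * c) (fun y => F y * c) :=
  (h.const_mul c).congr (fun _ => mul_comm _ _) (fun _ => mul_comm _ _)

lemma neg (h : IsInvFourier φ F) : IsInvFourier (fun x => -φ x) (fun y => -F y) :=
  (h.const_mul (-1)).congr (fun _ => by ring) (fun _ => by push_cast; ring)

lemma sub (h : IsInvFourier φ F) (h' : IsInvFourier ψ G) :
    IsInvFourier (fun x => φ x - ψ x) (fun y => F y - G y) :=
  (h.add h'.neg).congr (fun _ => by ring) (fun _ => by ring)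

lemma sum {ι : Type*} (s : Finset ι) {φ : ι → Space n → ℝ} {F : ι → Space n → ℂ}
    (h : ∀ i ∈ s, IsInvFourier (φ i) (F i)) :
    IsInvFourier (fun x => ∑ i ∈ s, φ i x) (fun y => ∑ i ∈ s, F i y) := by
  classical
  induction s using Finset.induction_on with
  | empty => simpa using zero
  | insert a s ha ih =>
    simp only [Finset.sum_insert ha]
    exact (h a (by simp)).add (ih fun i hi => h i (by simp [hi]))

lemma contDiff (h : IsInvFourier φ F) : ContDiff ℝ ∞ φ := by
  have h1 : φ = fun x => Complex.reCLM (𝓕⁻ F x) := by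
    ext x; rw [← h.2]; simp
  rw [h1]
  exact Complex.reCLM.contDiff.comp (contDiff_fourierInv h.1)

lemma pderiv (h : IsInvFourier φ F) (i : Fin n) :
    IsInvFourier (pderiv i φ) (fun y => 2 * Real.pi * Complex.I * (y i : ℂ) * F y) := by
  refine ⟨?_, fun x => ?_⟩
  · refine ((h.1.coord_mul i).const_mul (2 * Real.pi * Complex.I)).congr_ae
      (Filter.Eventually.of_forall fun y => by ring)
  · rw [← fderiv_fourierInv_apply h.1]
    have h1 : 𝓕⁻ F = fun x => Complex.ofRealCLM (φ x) := by
      ext x; rw [← h.2]; simp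
    have h2 := (Complex.ofRealCLM.hasFDerivAt (x := φ x)).comp x
      (h.contDiff.differentiable (by simp) x).hasFDerivAt
    have h3 : HasFDerivAt (𝓕⁻ F) (Complex.ofRealCLM.comp (fderiv ℝ φ x)) x := by
      rw [h1]; exact h2
    rw [h3.fderiv]
    rfl

lemma ae_eq (h : IsInvFourier φ F) (h' : IsInvFourier φ G) : F =ᵐ[volume] G := by
  have := ae_eq_zero_of_fourierInv_eq_zero (h.sub h').1.integrable fun x => by
    rw [← (h.sub h').2]; simp
  filter_upwards [this] with y hy
  exact sub_eq_zero.1 hy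

lemma ext (h : IsInvFourier φ F) (h' : IsInvFourier ψ G) (hFG : F =ᵐ[volume] G) (x : Space n) :
    φ x = ψ x := by
  have := Real.fourierInv_congr_ae hFG x
  rw [← h.2, ← h'.2] at this
  exact_mod_cast this

lemma ae_eq_zero (h : IsInvFourier φ F) (h0 : ∀ x, φ x = 0) : ∀ᵐ y, F y = 0 :=
  (h.congr (ψ := fun _ => 0) h0 fun _ => rfl).ae_eq zero

end IsInvFourier

/-- A function with nice Fourier transform is the inverse Fourier transform of a function with
finite moments. -/
lemma HasNiceFourier.exists_isInvFourier {n : ℕ} {φ : Space n → ℝ} (h : HasNiceFourier φ)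
    (hφ : Continuous φ) : ∃ F, IsInvFourier φ F := by
  obtain ⟨hL, F, hF, hs, hd⟩ := h
  have hF2 : MemLp F 2 volume := (memLp_congr_ae hF).1 (Lp.memLp _)
  have hFm : HasMoments F := by
    have hm := hF2.1
    refine ⟨hm, fun N => ?_⟩
    have : Fact (volume (Metric.ball (0 : Space n) 1) < ⊤) := ⟨measure_ball_lt_top⟩
    -- Near the origin only square integrability is known; it suffices on a ball of finite measure.
    have hb : IntegrableOn (fun y => ‖y‖ ^ N * ‖F y‖) (Metric.ball 0 1) volume := by
      have h1 : IntegrableOn F (Metric.ball 0 1) volume :=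
        (hF2.restrict _).integrable (by norm_num)
      refine h1.norm.mono' (by fun_prop) ?_
      filter_upwards [ae_restrict_mem Metric.isOpen_ball.measurableSet] with y hy
      rw [Real.norm_of_nonneg (by positivity)]
      have : ‖y‖ ≤ 1 := by simpa using (mem_ball_zero_iff.1 hy).le
      exact mul_le_of_le_one_left (norm_nonneg _) (pow_le_one₀ (norm_nonneg _) this)
    have hc : IntegrableOn (fun y => ‖y‖ ^ N * ‖F y‖) (Metric.ball 0 1)ᶜ volume := by
      -- The `n + 1` extra powers pay for integrability at infinity.
      obtain ⟨C, hC⟩ := hd (N + (n + 1))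
      have h1 : Integrable (fun y : Space n => (1 + ‖y‖) ^ (-((n + 1 : ℕ) : ℝ))) volume :=
        integrable_one_add_norm (by simp)
      refine ((h1.const_mul (C * 2 ^ (n + 1))).integrableOn).mono' (by fun_prop) ?_
      filter_upwards [ae_restrict_mem Metric.isOpen_ball.measurableSet.compl] with y hy
      have hy1 : 1 ≤ ‖y‖ := by simpa using hy
      rw [Real.norm_of_nonneg (by positivity), Real.rpow_neg (by positivity), Real.rpow_natCast,
        ← div_eq_mul_inv, le_div_iff₀ (by positivity)]
      have h2 : (1 + ‖y‖) ^ (n + 1) ≤ 2 ^ (n + 1) * ‖y‖ ^ (n + 1) := by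
        rw [← mul_pow]; gcongr; linarith
      calc ‖y‖ ^ N * ‖F y‖ * (1 + ‖y‖) ^ (n + 1)
          ≤ ‖y‖ ^ N * ‖F y‖ * (2 ^ (n + 1) * ‖y‖ ^ (n + 1)) := by gcongr
        _ = (‖y‖ ^ (N + (n + 1)) * ‖F y‖) * 2 ^ (n + 1) := by ring
        _ ≤ C * 2 ^ (n + 1) := by gcongr; exact hC y hy1
    exact integrableOn_univ.1 (by simpa using hb.union hc)
  refine ⟨F, hFm, fun x => ?_⟩
  have h1 : 𝓕 (hL.toLp (fun x => (φ x : ℂ))) = hF2.toLp F :=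
    Lp.ext (hF.trans hF2.coeFn_toLp.symm)
  have h2 : hL.toLp (fun x => (φ x : ℂ)) = 𝓕⁻ (hF2.toLp F) := by
    rw [← h1, FourierTransform.fourierInv_fourier_eq]
  have h3 : (fun x => (φ x : ℂ)) =ᵐ[volume] 𝓕⁻ F := by
    refine hL.coeFn_toLp.symm.trans ?_
    rw [h2]
    exact coeFn_fourierInv_toLp hFm.integrable hF2
  -- Both sides are continuous, so almost everywhere equality is equality.
  have h4 := (Continuous.ae_eq_iff_eq volume (by fun_prop)
    (contDiff_fourierInv hFm).continuous).1 h3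
  exact congrFun h4 x

/-! ### Symbols: stability under Riesz multipliers, integrability and decay. -/

/-- Functions on the plane that are smooth away from `0`, vanish to first order at `0`, and decrease
rapidly together with their difference quotients; they are the products of a Schwartz function
vanishing at `0` with a smooth function that is homogeneous of degree zero. -/
structure IsSymbol (F : Space 2 → ℂ) : Prop where
  smooth : ContDiffOn ℝ ∞ F {0}ᶜ
  bound : ∀ N : ℕ, ∃ C : ℝ, 0 ≤ C ∧ ∀ y, (1 + ‖y‖) ^ N * ‖F y‖ ≤ C * ‖y‖
  lipschitz : ∃ C : ℝ, 0 ≤ C ∧ ∀ y z, ‖y - z‖ ≤ 1 → (1 + ‖y‖) ^ 3 * ‖F y - F z‖ ≤ C * ‖y - z‖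
  hermitian : ∀ y, F (-y) = (starRingEnd ℂ) (F y)

/-- The symbol `i yᵢ / |y|` of a Riesz transform. -/
noncomputable def riesz (i : Fin 2) (y : Space 2) : ℂ := Complex.I * ((y i / ‖y‖ : ℝ) : ℂ)

lemma abs_coord_div_norm_le (i : Fin 2) (y : Space 2) : |y i / ‖y‖| ≤ 1 := by
  rw [abs_div, abs_norm]
  exact div_le_one_of_le₀ (by simpa using PiLp.norm_apply_le y i) (norm_nonneg _)

lemma norm_riesz_le (i : Fin 2) (y : Space 2) : ‖riesz i y‖ ≤ 1 := by
  rw [riesz, norm_mul, Complex.norm_I, one_mul, Complex.norm_real]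
  exact abs_coord_div_norm_le i y

/-- The jump of `riesz` at the origin is harmless after multiplication by `‖y‖`; this is what lets a
symbol, being `O(‖y‖)`, absorb it. -/
lemma norm_riesz_sub_le (i : Fin 2) (y z : Space 2) :
    ‖riesz i y - riesz i z‖ * ‖y‖ ≤ 2 * ‖y - z‖ := by
  have h0 : ∀ w : Space 2, w i / ‖w‖ * ‖w‖ = w i := fun w => by
    rcases eq_or_ne w 0 with rfl | hw
    · simp
    · exact div_mul_cancel₀ _ (norm_ne_zero_iff.2 hw)
  rw [riesz, riesz, ← mul_sub, norm_mul, Complex.norm_I, one_mul, ← Complex.ofReal_sub,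
    Complex.norm_real, Real.norm_eq_abs]
  have h1 := abs_coord_div_norm_le i z
  have hy := h0 y
  have hz := h0 z
  set a := y i / ‖y‖
  set b := z i / ‖z‖
  have h2 : (a - b) * ‖y‖ = (y - z) i + b * (‖z‖ - ‖y‖) := by
    have : (y - z) i = y i - z i := rfl
    rw [this]; linear_combination hy - hz
  have h3 : |(y - z) i| ≤ ‖y - z‖ := by simpa using PiLp.norm_apply_le (y - z) i
  have h4 : |‖z‖ - ‖y‖| ≤ ‖y - z‖ := by
    rw [abs_sub_comm]; exact abs_norm_sub_norm_le y z
  calc |a - b| * ‖y‖ = |(a - b) * ‖y‖| := by rw [abs_mul, abs_norm]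
    _ ≤ |(y - z) i| + |b| * |‖z‖ - ‖y‖| := by rw [h2, ← abs_mul]; exact abs_add_le _ _
    _ ≤ ‖y - z‖ + 1 * ‖y - z‖ := by gcongr
    _ = 2 * ‖y - z‖ := by ring

lemma riesz_neg (i : Fin 2) (y : Space 2) : riesz i (-y) = (starRingEnd ℂ) (riesz i y) := by
  simp [riesz, neg_div]

lemma contDiffOn_riesz (i : Fin 2) : ContDiffOn ℝ ∞ (riesz i) {0}ᶜ := by
  have h1 : ContDiffOn ℝ ∞ (fun y : Space 2 => y i / ‖y‖) {0}ᶜ := by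
    refine ContDiffOn.div (by fun_prop) ?_ fun y hy => norm_ne_zero_iff.2 hy
    exact contDiffOn_id.norm ℝ fun y hy => hy
  exact contDiffOn_const.mul (Complex.ofRealCLM.contDiff.comp_contDiffOn h1)

lemma norm_mul_riesz (i : Fin 2) (y : Space 2) :
    (‖y‖ : ℂ) * riesz i y = Complex.I * (y i : ℂ) := by
  rcases eq_or_ne y 0 with rfl | hw
  · simp
  · have : (‖y‖ : ℂ) ≠ 0 := by exact_mod_cast norm_ne_zero_iff.2 hw
    rw [riesz, Complex.ofReal_div]
    field_simp

/-- The sign comes from the factor `I`: the frame is orthogonal for the bilinear pairing, not the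
hermitian one. -/
lemma riesz_sq_add (y : Space 2) (hy : y ≠ 0) : riesz 0 y ^ 2 + riesz 1 y ^ 2 = -1 := by
  have h : (‖y‖ : ℂ) ≠ 0 := by exact_mod_cast norm_ne_zero_iff.2 hy
  have h1 : ((‖y‖ : ℝ) : ℂ) ^ 2 = (y 0 : ℂ) ^ 2 + (y 1 : ℂ) ^ 2 := by
    have := EuclideanSpace.real_norm_sq_eq y
    rw [Fin.sum_univ_two] at this
    exact_mod_cast this
  apply mul_left_cancel₀ (pow_ne_zero 2 h)
  have e0 := norm_mul_riesz 0 y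
  have e1 := norm_mul_riesz 1 y
  linear_combination (‖y‖ * riesz 0 y + Complex.I * (y 0 : ℂ)) * e0 +
    (‖y‖ * riesz 1 y + Complex.I * (y 1 : ℂ)) * e1 +
    ((y 0 : ℂ) ^ 2 + (y 1 : ℂ) ^ 2) * Complex.I_sq + h1

namespace IsSymbol

variable {F G : Space 2 → ℂ}

lemma apply_zero (hF : IsSymbol F) : F 0 = 0 := by
  obtain ⟨C, -, hC⟩ := hF.bound 0
  simpa using hC 0

lemma add (hF : IsSymbol F) (hG : IsSymbol G) : IsSymbol (fun y => F y + G y) := by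
  refine ⟨hF.1.add hG.1, fun N => ?_, ?_, fun y => by simp [hF.hermitian, hG.hermitian]⟩
  · obtain ⟨C, hC0, hC⟩ := hF.bound N
    obtain ⟨D, hD0, hD⟩ := hG.bound N
    refine ⟨C + D, by positivity, fun y => ?_⟩
    calc (1 + ‖y‖) ^ N * ‖F y + G y‖ ≤ (1 + ‖y‖) ^ N * (‖F y‖ + ‖G y‖) := by
          gcongr; exact norm_add_le _ _
      _ ≤ _ := by linarith [hC y, hD y]
  · obtain ⟨C, hC0, hC⟩ := hF.lipschitz
    obtain ⟨D, hD0, hD⟩ := hG.lipschitz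
    refine ⟨C + D, by positivity, fun y z h => ?_⟩
    have e : F y + G y - (F z + G z) = (F y - F z) + (G y - G z) := by ring
    calc (1 + ‖y‖) ^ 3 * ‖F y + G y - (F z + G z)‖
        ≤ (1 + ‖y‖) ^ 3 * (‖F y - F z‖ + ‖G y - G z‖) := by
          rw [e]; gcongr; exact norm_add_le _ _
      _ ≤ _ := by linarith [hC y z h, hD y z h]

lemma const_mul (c : ℝ) (hF : IsSymbol F) : IsSymbol (fun y => c * F y) := by
  refine ⟨contDiffOn_const.mul hF.1, fun N => ?_, ?_, fun y => by simp [hF.hermitian]⟩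
  · obtain ⟨C, hC0, hC⟩ := hF.bound N
    refine ⟨|c| * C, by positivity, fun y => ?_⟩
    rw [norm_mul, Complex.norm_real, Real.norm_eq_abs, mul_assoc, mul_left_comm]
    exact mul_le_mul_of_nonneg_left (hC y) (abs_nonneg c)
  · obtain ⟨C, hC0, hC⟩ := hF.lipschitz
    refine ⟨|c| * C, by positivity, fun y z h => ?_⟩
    rw [← mul_sub, norm_mul, Complex.norm_real, Real.norm_eq_abs, mul_assoc, mul_left_comm]
    exact mul_le_mul_of_nonneg_left (hC y z h) (abs_nonneg c)

lemma mul_const (c : ℝ) (hF : IsSymbol F) : IsSymbol (fun y => F y * c) := by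
  simpa only [mul_comm] using hF.const_mul c

lemma neg (hF : IsSymbol F) : IsSymbol (fun y => -F y) := by
  simpa using hF.const_mul (-1)

lemma sub (hF : IsSymbol F) (hG : IsSymbol G) : IsSymbol (fun y => F y - G y) := by
  simpa only [sub_eq_add_neg] using hF.add hG.neg

/-- For the Lipschitz bound the difference is split so that the increment of `riesz` meets `F y`,
whose vanishing at the origin compensates it. -/
lemma riesz_mul (i : Fin 2) (hF : IsSymbol F) : IsSymbol (fun y => riesz i y * F y) := by
  refine ⟨(contDiffOn_riesz i).mul hF.1, fun N => ?_, ?_, fun y => by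
    simp [hF.hermitian, riesz_neg]⟩
  · obtain ⟨C, hC0, hC⟩ := hF.bound N
    refine ⟨C, hC0, fun y => le_trans ?_ (hC y)⟩
    rw [norm_mul]
    gcongr
    exact mul_le_of_le_one_left (norm_nonneg _) (norm_riesz_le i y)
  · obtain ⟨C, hC0, hC⟩ := hF.lipschitz
    obtain ⟨D, hD0, hD⟩ := hF.bound 3
    refine ⟨2 * D + C, by positivity, fun y z h => ?_⟩
    have e : riesz i y * F y - riesz i z * F z =
      (riesz i y - riesz i z) * F y + riesz i z * (F y - F z) := by ring
    have h1 := norm_riesz_sub_le i y z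
    calc (1 + ‖y‖) ^ 3 * ‖riesz i y * F y - riesz i z * F z‖
        ≤ (1 + ‖y‖) ^ 3 * (‖riesz i y - riesz i z‖ * ‖F y‖ + ‖riesz i z‖ * ‖F y - F z‖) := by
          rw [e, ← norm_mul, ← norm_mul]; gcongr; exact norm_add_le _ _
      _ = ‖riesz i y - riesz i z‖ * ((1 + ‖y‖) ^ 3 * ‖F y‖) +
          ‖riesz i z‖ * ((1 + ‖y‖) ^ 3 * ‖F y - F z‖) := by ring
      _ ≤ ‖riesz i y - riesz i z‖ * (D * ‖y‖) + 1 * (C * ‖y - z‖) := by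
          exact add_le_add (mul_le_mul_of_nonneg_left (hD y) (norm_nonneg _))
            (mul_le_mul (norm_riesz_le i z) (hC y z h) (by positivity) zero_le_one)
      _ = D * (‖riesz i y - riesz i z‖ * ‖y‖) + C * ‖y - z‖ := by ring
      _ ≤ D * (2 * ‖y - z‖) + C * ‖y - z‖ := by gcongr
      _ = _ := by ring

/-- A Schwartz function that is hermitian and vanishes at the origin is a symbol. -/
lemma of_schwartz (ψ : 𝓢(Space 2, ℂ)) (h0 : ψ 0 = 0)
    (hh : ∀ y, ψ (-y) = (starRingEnd ℂ) (ψ y)) : IsSymbol ψ := by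
  have hb : ∀ N k : ℕ, ∃ C : ℝ, 0 ≤ C ∧
      ∀ y, (1 + ‖y‖) ^ N * ‖iteratedFDeriv ℝ k ψ y‖ ≤ C := fun N k =>
    ⟨2 ^ N * ((Finset.Iic (N, k)).sup fun m => SchwartzMap.seminorm ℝ m.1 m.2) ψ,
      by positivity, fun y => SchwartzMap.one_add_le_sup_seminorm_apply (𝕜 := ℝ) (m := (N, k))
        le_rfl le_rfl ψ y⟩
  have hl : ∃ C : ℝ, 0 ≤ C ∧ ∀ y z, ‖y - z‖ ≤ 1 →
      (1 + ‖y‖) ^ 3 * ‖ψ y - ψ z‖ ≤ C * ‖y - z‖ := by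
    obtain ⟨C, hC0, hC⟩ := hb 3 1
    refine ⟨8 * C, by positivity, fun y z h => ?_⟩
    -- On the unit ball around `y` one has `1 + ‖y‖ ≤ 2 (1 + ‖w‖)`; the cube gives the factor `8`.
    have h1 : ∀ w ∈ Metric.closedBall y 1, ‖fderiv ℝ ψ w‖ ≤ 8 * C / (1 + ‖y‖) ^ 3 := by
      intro w hw
      have h2 := hC w
      rw [norm_iteratedFDeriv_one] at h2
      rw [le_div_iff₀ (by positivity)]
      have h3 : ‖y‖ ≤ ‖w‖ + 1 := by
        have h4 : ‖w - y‖ ≤ 1 := mem_closedBall_iff_norm.1 hw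
        have h5 := norm_sub_norm_le y w
        rw [norm_sub_rev] at h5
        linarith
      calc ‖fderiv ℝ ψ w‖ * (1 + ‖y‖) ^ 3 ≤ ‖fderiv ℝ ψ w‖ * (2 * (1 + ‖w‖)) ^ 3 := by
            gcongr; linarith [norm_nonneg w]
        _ = 8 * ((1 + ‖w‖) ^ 3 * ‖fderiv ℝ ψ w‖) := by ring
        _ ≤ 8 * C := by gcongr
    have h2 := (convex_closedBall y 1).norm_image_sub_le_of_norm_fderiv_le (𝕜 := ℝ)
      (fun w _ => ψ.differentiableAt) h1
      (x := z) (y := y) (by rw [mem_closedBall_iff_norm, norm_sub_rev]; exact h) (by simp)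
    rw [mul_comm, ← le_div_iff₀ (by positivity)]
    exact h2.trans (le_of_eq (by ring))
  refine ⟨(ψ.smooth ⊤).contDiffOn, fun N => ?_, hl, hh⟩
  obtain ⟨C, hC0, hC⟩ := hl
  obtain ⟨D, hD0, hD⟩ := hb N 0
  refine ⟨2 ^ N * C + D, by positivity, fun y => ?_⟩
  -- Near the origin the Lipschitz bound against `ψ 0 = 0` gives the factor `‖y‖`; away from it, `1
  -- ≤ ‖y‖` is free.
  rcases le_total ‖y‖ 1 with hy | hy
  · have h1 := hC y 0 (by simpa using hy)
    rw [h0, sub_zero, sub_zero] at h1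
    have h2 : ‖ψ y‖ ≤ C * ‖y‖ := le_trans
      (le_mul_of_one_le_left (norm_nonneg _) (one_le_pow₀ (by linarith [norm_nonneg y]))) h1
    calc (1 + ‖y‖) ^ N * ‖ψ y‖ ≤ 2 ^ N * (C * ‖y‖) := by gcongr; linarith
      _ ≤ (2 ^ N * C + D) * ‖y‖ := by nlinarith [norm_nonneg y]
  · have h1 := hD y
    rw [norm_iteratedFDeriv_zero] at h1
    have h2 : 0 ≤ 2 ^ N * C := by positivity
    nlinarith

lemma aestronglyMeasurable (hF : IsSymbol F) : AEStronglyMeasurable F volume := by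
  rw [← restrict_compl_singleton (μ := volume) (0 : Space 2)]
  exact hF.smooth.continuousOn.aestronglyMeasurable
    (MeasurableSet.singleton _).compl

/-- In polar coordinates the Jacobian `r` of the plane cancels the singularity `r⁻¹`. -/
lemma integrable_inv_norm_mul :
    Integrable (fun y : Space 2 => ‖y‖⁻¹ * ((1 + ‖y‖) ^ 2)⁻¹) volume := by
  have h := integrable_fun_norm_addHaar (volume : Measure (Space 2))
    (f := fun r : ℝ => r⁻¹ * ((1 + r) ^ 2)⁻¹)
  refine h.2 ?_
  have h1 : IntegrableOn (fun r : ℝ => (1 + ‖r‖) ^ (-(2 : ℝ))) (Set.Ioi 0) :=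
    (integrable_one_add_norm (by simp)).integrableOn
  refine h1.congr_fun (fun r hr => ?_) measurableSet_Ioi
  have hr : 0 < r := hr
  simp only [finrank_euclideanSpace, Fintype.card_fin, smul_eq_mul]
  rw [Real.norm_of_nonneg hr.le, Real.rpow_neg (by positivity)]
  norm_num
  field_simp

/-- First-order vanishing of `F` reduces `‖y‖⁻²` to the locally integrable `‖y‖⁻¹`. -/
lemma hasMoments_inv_norm_sq (hF : IsSymbol F) :
    HasMoments (fun y => ((‖y‖⁻¹ : ℝ) : ℂ) ^ 2 * F y) := by
  have hm := hF.aestronglyMeasurable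
  have hm1 : AEStronglyMeasurable (fun y : Space 2 => ((‖y‖⁻¹ : ℝ) : ℂ) ^ 2) volume :=
    (by fun_prop : Measurable fun y : Space 2 => ((‖y‖⁻¹ : ℝ) : ℂ) ^ 2).aestronglyMeasurable
  have hm2 := hm1.mul hm
  refine ⟨hm2, fun N => ?_⟩
  obtain ⟨C, hC0, hC⟩ := hF.bound (N + 2)
  refine (integrable_inv_norm_mul.const_mul C).mono' ?_ ?_
  · exact ((by fun_prop : Continuous fun y : Space 2 => ‖y‖ ^ N).aestronglyMeasurable).mul hm2.norm
  · filter_upwards with y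
    rw [Real.norm_of_nonneg (by positivity), norm_mul, norm_pow, Complex.norm_real,
      Real.norm_of_nonneg (by positivity)]
    rcases eq_or_ne y 0 with rfl | hy
    · simp
    have hy' : 0 < ‖y‖ := norm_pos_iff.2 hy
    have h1 : ‖y‖ ^ N * ‖F y‖ ≤ C * ‖y‖ * ((1 + ‖y‖) ^ 2)⁻¹ := by
      rw [← div_eq_mul_inv, le_div_iff₀ (by positivity)]
      calc ‖y‖ ^ N * ‖F y‖ * (1 + ‖y‖) ^ 2 ≤ (1 + ‖y‖) ^ N * ‖F y‖ * (1 + ‖y‖) ^ 2 := by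
            gcongr; linarith
        _ = (1 + ‖y‖) ^ (N + 2) * ‖F y‖ := by ring
        _ ≤ C * ‖y‖ := hC y
    calc ‖y‖ ^ N * (‖y‖⁻¹ ^ 2 * ‖F y‖) = ‖y‖⁻¹ ^ 2 * (‖y‖ ^ N * ‖F y‖) := by ring
      _ ≤ ‖y‖⁻¹ ^ 2 * (C * ‖y‖ * ((1 + ‖y‖) ^ 2)⁻¹) := by gcongr
      _ = C * (‖y‖⁻¹ * ((1 + ‖y‖) ^ 2)⁻¹) := by field_simp

end IsSymbol

lemma HasMoments.norm_mul {n : ℕ} {F : Space n → ℂ} (hF : HasMoments F) :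
    HasMoments (fun y => (‖y‖ : ℂ) * F y) := by
  have h1 := hF.1
  have hm : AEStronglyMeasurable (fun y : Space n => (‖y‖ : ℂ) * F y) volume :=
    (by fun_prop : Continuous fun y : Space n => (‖y‖ : ℂ)).aestronglyMeasurable.mul h1
  refine ⟨hm, fun N => (hF.2 (N + 1)).congr ?_⟩
  filter_upwards with y
  rw [_root_.norm_mul, Complex.norm_real, norm_norm]
  ring

namespace IsSymbol

variable {F G : Space 2 → ℂ}

lemma hasMoments_inv_norm (hF : IsSymbol F) :
    HasMoments (fun y => ((‖y‖⁻¹ : ℝ) : ℂ) * F y) := by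
  refine hF.hasMoments_inv_norm_sq.norm_mul.congr_ae (Filter.Eventually.of_forall fun y => ?_)
  rcases eq_or_ne y 0 with rfl | hy
  · simp
  · have : (‖y‖ : ℂ) ≠ 0 := by exact_mod_cast norm_ne_zero_iff.2 hy
    push_cast
    field_simp

lemma hasMoments (hF : IsSymbol F) : HasMoments F := by
  refine hF.hasMoments_inv_norm.norm_mul.congr_ae (Filter.Eventually.of_forall fun y => ?_)
  rcases eq_or_ne y 0 with rfl | hy
  · simp [hF.apply_zero]
  · have : (‖y‖ : ℂ) ≠ 0 := by exact_mod_cast norm_ne_zero_iff.2 hy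
    push_cast
    field_simp

lemma memLp_two (hF : IsSymbol F) : MemLp F 2 volume := by
  rw [memLp_two_iff_integrable_sq_norm hF.aestronglyMeasurable]
  obtain ⟨C, hC0, hC⟩ := hF.bound 1
  refine (hF.hasMoments.integrable.norm.const_mul C).mono' ?_ ?_
  · exact hF.aestronglyMeasurable.norm.pow 2
  · filter_upwards with y
    have h1 : ‖F y‖ ≤ C := by
      have h2 := hC y
      have h3 : (1 + ‖y‖) * ‖F y‖ ≤ (1 + ‖y‖) * C := by nlinarith
      exact le_of_mul_le_mul_left h3 (by positivity)
    rw [Real.norm_of_nonneg (by positivity), sq]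
    gcongr

/-- Translating by half a period of the character replaces `F` by half the difference `F v - F (v +
h)` with `‖h‖ = 1/(2‖x‖)`, so the Lipschitz bound gains a factor `1/‖x‖`. The weight `(1 + ‖v‖)⁻³`
is integrable on the plane. -/
lemma norm_fourierInv_le (hF : IsSymbol F) :
    ∃ C : ℝ, ∀ x, ‖𝓕⁻ F x‖ ≤ C * (1 + ‖x‖)⁻¹ := by
  obtain ⟨L, hL0, hL⟩ := hF.lipschitz
  have hJ : Integrable (fun y : Space 2 => (1 + ‖y‖) ^ (-(3 : ℝ))) volume :=
    integrable_one_add_norm (by simp; norm_num)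
  set J := ∫ y : Space 2, (1 + ‖y‖) ^ (-(3 : ℝ)) with hJd
  have hJ0 : 0 ≤ J := integral_nonneg fun y => by positivity
  set M := ∫ y, ‖F y‖ with hM
  have hM0 : 0 ≤ M := integral_nonneg fun y => by positivity
  refine ⟨2 * M + 2 * (L * J), fun x => ?_⟩
  rw [← div_eq_mul_inv, le_div_iff₀ (by positivity)]
  -- The threshold is where `‖h‖ ≤ 1`, the range of the Lipschitz bound.
  rcases le_total ‖x‖ (1 / 2) with hx | hx
  · have h1 : ‖𝓕⁻ F x‖ ≤ M := by
      rw [Real.fourierInv_eq]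
      refine (norm_integral_le_integral_norm _).trans (le_of_eq ?_)
      simp only [Circle.norm_smul, hM]
    have : 0 ≤ L * J := by positivity
    nlinarith [norm_nonneg x]
  · have hx0 : 0 < ‖x‖ := by linarith
    have hne : -x ≠ 0 := by
      rw [neg_ne_zero]; exact norm_pos_iff.1 hx0
    have h1 := fourierIntegral_eq_half_sub_half_period_translate hne hF.hasMoments.integrable
    have h2 : 𝓕⁻ F x = ∫ v, Real.fourierChar (-inner ℝ v (-x)) • F v := by
      rw [Real.fourierInv_eq]; simp
    rw [h2, h1]
    set h : Space 2 := (1 / (2 * ‖-x‖ ^ 2)) • -x with hh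
    have hn : ‖h‖ = 1 / (2 * ‖x‖) := by
      rw [hh, norm_smul, norm_neg, Real.norm_of_nonneg (by positivity)]
      field_simp
    have hn1 : ‖h‖ ≤ 1 := by
      rw [hn, div_le_one (by positivity)]; linarith
    have h3 : ‖∫ v, Real.fourierChar (-inner ℝ v (-x)) • (F v - F (v + h))‖ ≤
        ∫ v : Space 2, L * ‖h‖ * (1 + ‖v‖) ^ (-(3 : ℝ)) := by
      refine norm_integral_le_of_norm_le (hJ.const_mul _) (Filter.Eventually.of_forall fun v => ?_)
      have h4 := hL v (v + h) (by simpa using hn1)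
      rw [Circle.norm_smul, Real.rpow_neg (by positivity), ← div_eq_mul_inv,
        le_div_iff₀ (by positivity), mul_comm]
      have h5 : (1 + ‖v‖) ^ (3 : ℝ) = (1 + ‖v‖) ^ 3 := by norm_cast
      rw [h5]
      simpa using h4
    rw [integral_const_mul, ← hJd, hn] at h3
    rw [norm_smul]
    have h6 : ‖(1 / (2 : ℂ))‖ = 1 / 2 := by simp
    rw [h6]
    generalize ‖∫ v, Real.fourierChar (-inner ℝ v (-x)) • (F v - F (v + h))‖ = A at h3 ⊢
    clear_value J M
    generalize ‖x‖ = r at h3 hx hx0 ⊢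
    have h7 : 0 ≤ L * J := by positivity
    calc 1 / 2 * A * (1 + r) ≤ 1 / 2 * (L * (1 / (2 * r)) * J) * (3 * r) := by
          gcongr
          linarith
      _ = 3 / 4 * (L * J) := by field_simp; ring
      _ ≤ 2 * M + 2 * (L * J) := by linarith

end IsSymbol

/-! ### From symbols to fields of class `𝒜₂`, and symmetries of `K` and `H`. -/

/-- The inverse Fourier transform of a hermitian function is real. -/
lemma HasMoments.isInvFourier_re {n : ℕ} {F : Space n → ℂ} (hF : HasMoments F)
    (hh : ∀ y, F (-y) = (starRingEnd ℂ) (F y)) : IsInvFourier (fun x => (𝓕⁻ F x).re) F := by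
  refine ⟨hF, fun x => ?_⟩
  rw [← Complex.conj_eq_iff_re, Real.fourierInv_eq, ← integral_conj,
    ← integral_neg_eq_self (fun v => Real.fourierChar (inner ℝ v x) • F v)]
  congr 1
  ext v
  rw [hh, inner_neg_left, Circle.smul_def, Circle.smul_def, smul_eq_mul, smul_eq_mul, map_mul,
    AddChar.map_neg_eq_inv, Circle.coe_inv_eq_conj]

section

variable {φ : Space 2 → ℝ} {F : Space 2 → ℂ}

lemma IsSymbol.memLp_ofReal (hF : IsSymbol F) (h : IsInvFourier φ F) :
    MemLp (fun x => (φ x : ℂ)) 2 volume := by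
  have h1 := coeFn_fourierInv_toLp hF.hasMoments.integrable hF.memLp_two
  have h2 : (fun x => (φ x : ℂ)) = 𝓕⁻ F := funext h.2
  rw [h2]
  exact (memLp_congr_ae h1).1 (Lp.memLp _)

lemma IsSymbol.memLp (hF : IsSymbol F) (h : IsInvFourier φ F) : MemLp φ 2 volume := by
  simpa using (hF.memLp_ofReal h).re

lemma IsSymbol.hasNiceFourier (hF : IsSymbol F) (h : IsInvFourier φ F) : HasNiceFourier φ := by
  refine ⟨hF.memLp_ofReal h, F, ?_, hF.smooth, fun N => ?_⟩
  · have h1 := coeFn_fourierInv_toLp hF.hasMoments.integrable hF.memLp_two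
    have h2 : (hF.memLp_ofReal h).toLp (fun x => (φ x : ℂ)) = 𝓕⁻ (hF.memLp_two.toLp F) := by
      refine Lp.ext ((MemLp.coeFn_toLp _).trans ?_)
      rw [show (fun x => (φ x : ℂ)) = 𝓕⁻ F from funext h.2]
      exact h1.symm
    rw [h2, FourierTransform.fourier_fourierInv_eq]
    exact hF.memLp_two.coeFn_toLp
  · obtain ⟨C, hC0, hC⟩ := hF.bound (N + 1)
    refine ⟨C, fun y hy => ?_⟩
    have hy0 : 0 < ‖y‖ := by linarith
    refine le_of_mul_le_mul_right (le_trans ?_ (hC y)) hy0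
    calc ‖y‖ ^ N * ‖F y‖ * ‖y‖ = ‖y‖ ^ (N + 1) * ‖F y‖ := by ring
      _ ≤ (1 + ‖y‖) ^ (N + 1) * ‖F y‖ := by gcongr; linarith

lemma IsSymbol.abs_le (hF : IsSymbol F) (h : IsInvFourier φ F) :
    ∃ C : ℝ, ∀ x, |φ x| ≤ C * (1 + ‖x‖) ^ (1 - ((2 : ℕ) : ℤ)) := by
  obtain ⟨C, hC⟩ := hF.norm_fourierInv_le
  refine ⟨C, fun x => ?_⟩
  have h1 : |φ x| = ‖𝓕⁻ F x‖ := by rw [← h.2, Complex.norm_real, Real.norm_eq_abs]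
  rw [h1, show (1 - ((2 : ℕ) : ℤ)) = -1 by norm_num, zpow_neg_one]
  exact hC x

end

/-- Tensor fields all of whose components have a symbol as Fourier transform are in `𝒜₂`. -/
lemma MemA2.of_isSymbol {w : TensorField4 2} {W : Fin 2 → Fin 2 → Fin 2 → Fin 2 → Space 2 → ℂ}
    (he : IsElastic2 w) (h : ∀ i j k l, IsInvFourier (fun x => w x i j k l) (W i j k l))
    (hW : ∀ i j k l, IsSymbol (W i j k l)) : MemA2 w := by
  refine ⟨he, fun i j k l => (h i j k l).contDiff, fun i j k l => (hW i j k l).memLp (h i j k l),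
    ?_, fun i j k l => (hW i j k l).hasNiceFourier (h i j k l)⟩
  choose C hC using fun i j k l => (hW i j k l).abs_le (h i j k l)
  refine ⟨∑ i, ∑ j, ∑ k, ∑ l, |C i j k l|, fun x i j k l => (hC i j k l x).trans ?_⟩
  gcongr
  calc C i j k l ≤ |C i j k l| := le_abs_self _
    _ ≤ ∑ l, |C i j k l| := Finset.single_le_sum (f := fun l => |C i j k l|)
        (fun _ _ => by positivity) (Finset.mem_univ l)
    _ ≤ ∑ k, ∑ l, |C i j k l| := Finset.single_le_sum (f := fun k => ∑ l, |C i j k l|)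
        (fun _ _ => by positivity) (Finset.mem_univ k)
    _ ≤ ∑ j, ∑ k, ∑ l, |C i j k l| := Finset.single_le_sum (f := fun j => ∑ k, ∑ l, |C i j k l|)
        (fun _ _ => by positivity) (Finset.mem_univ j)
    _ ≤ ∑ i, ∑ j, ∑ k, ∑ l, |C i j k l| :=
      Finset.single_le_sum (f := fun i => ∑ j, ∑ k, ∑ l, |C i j k l|)
        (fun _ _ => by positivity) (Finset.mem_univ i)

/-- The Fourier transform of a real Schwartz function with vanishing integral is a symbol. -/
lemma exists_isSymbol_of_schwartz (φ : 𝓢(Space 2, ℝ)) (h0 : ∫ x, φ x = 0) :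
    ∃ F, IsInvFourier φ F ∧ IsSymbol F := by
  let ψ : 𝓢(Space 2, ℂ) := φ.postcompCLM Complex.ofRealCLM
  have hψ : ∀ x, ψ x = (φ x : ℂ) := fun x => rfl
  have hF : IsSymbol (𝓕 ψ : 𝓢(Space 2, ℂ)) := by
    refine IsSymbol.of_schwartz _ ?_ fun y => ?_
    -- The value of the transform at the origin is the integral of `φ`.
    · rw [SchwartzMap.fourier_coe, Real.fourier_eq]
      simp only [inner_zero_right, neg_zero, AddChar.map_zero_eq_one, one_smul, hψ]
      rw [integral_complex_ofReal, h0, Complex.ofReal_zero]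
    · rw [SchwartzMap.fourier_coe, Real.fourier_eq, Real.fourier_eq, ← integral_conj]
      congr 1
      ext v
      rw [inner_neg_right, neg_neg, Circle.smul_def, Circle.smul_def, smul_eq_mul, smul_eq_mul,
        map_mul, AddChar.map_neg_eq_inv, Circle.coe_inv_eq_conj, hψ, Complex.conj_ofReal,
        Complex.conj_conj]
  refine ⟨_, ⟨hF.hasMoments, fun x => ?_⟩, hF⟩
  rw [← SchwartzMap.fourierInv_coe, FourierTransform.fourierInv_fourier_eq, hψ]

lemma pderiv_comm {n : ℕ} {f : Space n → ℝ} (hf : ContDiff ℝ ∞ f) (i j : Fin n) (x : Space n) :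
    pderiv i (pderiv j f) x = pderiv j (pderiv i f) x := by
  have h : ∀ i j : Fin n, pderiv i (pderiv j f) x =
      fderiv ℝ (fderiv ℝ f) x (EuclideanSpace.single i 1) (EuclideanSpace.single j 1) := by
    intro i j
    have h1 : DifferentiableAt ℝ (fderiv ℝ f) x :=
      (hf.fderiv_right (m := 1) (by norm_cast)).differentiable (by simp) x
    exact DFunLike.congr_fun (h1.hasFDerivAt.clm_apply
      (hasFDerivAt_const (EuclideanSpace.single j (1 : ℝ)) x)).fderiv _ |>.trans (by simp)
  rw [h i j, h j i]
  exact (hf.contDiffAt.isSymmSndFDerivAt (by simp; norm_cast)) _ _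

lemma kron_comm {n : ℕ} (i j : Fin n) : kron i j = kron j i := by
  simp only [kron, eq_comm]

lemma isElastic2_opK {n : ℕ} (u : VectorField n) : IsElastic2 (opK u) := by
  intro x i j k l
  refine ⟨?_, ?_, ?_⟩ <;> simp only [opK, kron_comm i j, kron_comm k l] <;> ring

lemma isElastic2_opH {n : ℕ} {v : TensorField2 n} (hv : IsElastic1 v)
    (hs : ∀ i j, ContDiff ℝ ∞ (fun x => v x i j)) : IsElastic2 (opH v) := by
  have h : ∀ i j, (fun z => v z i j) = fun z => v z j i := fun i j => funext fun z => hv z i j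
  intro x i j k l
  refine ⟨?_, ?_, ?_⟩ <;> simp only [opH]
  · rw [pderiv_comm (hs k l) i j, h i j]
  · rw [pderiv_comm (hs i j) k l, h k l]
  · ring

/-! ### The frame of symmetric tensors and its coefficients. -/

/-- The rotation by a quarter turn of the vector `riesz`. -/
noncomputable def rieszPerp (i : Fin 2) (y : Space 2) : ℂ := ![-riesz 1 y, riesz 0 y] i

/-- An orthogonal frame of the symmetric tensors, made of the symmetric products of `riesz` and
`rieszPerp`. -/
noncomputable def frame (p : Fin 3) (i j : Fin 2) (y : Space 2) : ℂ :=
  ![riesz i y * riesz j y, (riesz i y * rieszPerp j y + riesz j y * rieszPerp i y) / 2,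
    rieszPerp i y * rieszPerp j y] p

/-- The coefficients of a `4`-tensor with respect to `frame`. -/
noncomputable def frameCoeff (W : Fin 2 → Fin 2 → Fin 2 → Fin 2 → Space 2 → ℂ) (p q : Fin 3)
    (y : Space 2) : ℂ :=
  ∑ i, ∑ j, frame p i j y * ∑ k, ∑ l, frame q k l y * W i j k l y

lemma frame_comm (p : Fin 3) (i j : Fin 2) (y : Space 2) : frame p i j y = frame p j i y := by
  fin_cases p <;> simp [frame] <;> ring

/-- The weights `1, 2, 1` are the inverse squared lengths of the frame tensors: the symmetrized
mixed product has squared length `1/2`. -/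
lemma eq_sum_frame {y : Space 2} (hy : y ≠ 0) (A : Fin 2 → Fin 2 → ℂ) (hA : A 0 1 = A 1 0)
    (i j : Fin 2) : A i j = ∑ p, ![1, 2, 1] p * frame p i j y * ∑ k, ∑ l, frame p k l y * A k l := by
  have h := riesz_sq_add y hy
  simp only [Fin.sum_univ_two, Fin.sum_univ_three, frame, rieszPerp]
  fin_cases i <;> fin_cases j <;> simp [hA]
  · linear_combination (riesz 0 y ^ 2 + riesz 1 y ^ 2 - 1) * (-A 0 0) * h
  · linear_combination (riesz 0 y ^ 2 + riesz 1 y ^ 2 - 1) * (-A 1 0) * h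
  · linear_combination (riesz 0 y ^ 2 + riesz 1 y ^ 2 - 1) * (-A 1 0) * h
  · linear_combination (riesz 0 y ^ 2 + riesz 1 y ^ 2 - 1) * (-A 1 1) * h

/-- An elastic tensor is determined by its coefficients with respect to `frame`. -/
lemma eq_sum_frameCoeff {y : Space 2} (hy : y ≠ 0)
    (W : Fin 2 → Fin 2 → Fin 2 → Fin 2 → Space 2 → ℂ)
    (h1 : ∀ i j k l, W i j k l y = W j i k l y) (h2 : ∀ i j k l, W i j k l y = W i j l k y)
    (i j k l : Fin 2) :
    W i j k l y = ∑ p, ∑ q, ![1, 2, 1] p * ![1, 2, 1] q * frame p i j y * frame q k l y *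
      frameCoeff W p q y := by
  rw [eq_sum_frame hy (fun i j => W i j k l y) (h1 0 1 k l) i j]
  refine Finset.sum_congr rfl fun p _ => ?_
  rw [eq_sum_frame hy (fun k l => ∑ i, ∑ j, frame p i j y * W i j k l y)
    (by simp only [h2 _ _ 0 1]) k l, Finset.mul_sum]
  refine Finset.sum_congr rfl fun q _ => ?_
  have : ∑ k, ∑ l, frame q k l y * ∑ i, ∑ j, frame p i j y * W i j k l y = frameCoeff W p q y := by
    simp only [frameCoeff, Fin.sum_univ_two]
    ring
  rw [this]
  ring

lemma frameCoeff_comm {y : Space 2} {W : Fin 2 → Fin 2 → Fin 2 → Fin 2 → Space 2 → ℂ}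
    (h : ∀ i j k l, W i j k l y = W k l i j y) (p q : Fin 3) :
    frameCoeff W p q y = frameCoeff W q p y := by
  simp only [frameCoeff, Fin.sum_univ_two, h 1 1 0 0, h 0 1 0 0, h 1 0 0 0, h 1 1 0 1,
    h 1 1 1 0, h 1 0 0 1]
  ring

lemma frameCoeff_sub (V W : Fin 2 → Fin 2 → Fin 2 → Fin 2 → Space 2 → ℂ) (p q : Fin 3)
    (y : Space 2) : frameCoeff (fun i j k l y => V i j k l y - W i j k l y) p q y =
      frameCoeff V p q y - frameCoeff W p q y := by
  simp only [frameCoeff, mul_sub, Finset.sum_sub_distrib]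

namespace IsSymbol

variable {F G : Space 2 → ℂ}

lemma zero : IsSymbol (fun _ => 0) := by
  refine ⟨contDiffOn_const, fun N => ⟨0, le_rfl, by simp⟩, ⟨0, le_rfl, by simp⟩, by simp⟩

lemma sum {ι : Type*} (s : Finset ι) {F : ι → Space 2 → ℂ} (h : ∀ i ∈ s, IsSymbol (F i)) :
    IsSymbol (fun y => ∑ i ∈ s, F i y) := by
  classical
  induction s using Finset.induction_on with
  | empty => simpa using zero
  | insert a s ha ih =>
    simp only [Finset.sum_insert ha]
    exact (h a (by simp)).add (ih fun i hi => h i (by simp [hi]))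

lemma rieszPerp_mul (hF : IsSymbol F) (i : Fin 2) : IsSymbol (fun y => rieszPerp i y * F y) := by
  fin_cases i
  · simpa [rieszPerp] using (hF.riesz_mul 1).neg
  · simpa [rieszPerp] using hF.riesz_mul 0

lemma frame_mul (hF : IsSymbol F) (p : Fin 3) (i j : Fin 2) :
    IsSymbol (fun y => frame p i j y * F y) := by
  fin_cases p
  · simpa [frame, mul_assoc] using (hF.riesz_mul j).riesz_mul i
  · have := (((hF.rieszPerp_mul j).riesz_mul i).add
      ((hF.rieszPerp_mul i).riesz_mul j)).const_mul (1 / 2)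
    convert this using 2 with y
    simp [frame]
    ring
  · simpa [frame, mul_assoc] using (hF.rieszPerp_mul j).rieszPerp_mul i

lemma frameCoeff {W : Fin 2 → Fin 2 → Fin 2 → Fin 2 → Space 2 → ℂ}
    (hW : ∀ i j k l, IsSymbol (W i j k l)) (p q : Fin 3) : IsSymbol (frameCoeff W p q) :=
  sum _ fun i _ => sum _ fun j _ => frame_mul (sum _ fun k _ => sum _ fun l _ =>
    (hW i j k l).frame_mul q k l) p i j

lemma coord_mul_inv_norm (hF : IsSymbol F) (i : Fin 2) (y : Space 2) :
    2 * Real.pi * Complex.I * (y i : ℂ) * (((‖y‖⁻¹ : ℝ) : ℂ) * F y) =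
      2 * Real.pi * (riesz i y * F y) := by
  rcases eq_or_ne y 0 with rfl | hy
  · simp [hF.apply_zero]
  · have h : (‖y‖ : ℂ) ≠ 0 := by exact_mod_cast norm_ne_zero_iff.2 hy
    have h1 := norm_mul_riesz i y
    have h2 : (‖y‖ : ℂ) * ((‖y‖⁻¹ : ℝ) : ℂ) = 1 := by push_cast; field_simp
    linear_combination (-2 * Real.pi * ((‖y‖⁻¹ : ℝ) : ℂ) * F y) * h1 +
      2 * Real.pi * riesz i y * F y * h2

lemma coord_mul_coord_mul_inv_norm_sq (hF : IsSymbol F) (i j : Fin 2) (y : Space 2) :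
    2 * Real.pi * Complex.I * (y i : ℂ) * (2 * Real.pi * Complex.I * (y j : ℂ) *
      (((‖y‖⁻¹ : ℝ) : ℂ) ^ 2 * F y)) = 4 * Real.pi ^ 2 * (riesz i y * (riesz j y * F y)) := by
  have h1 := hF.coord_mul_inv_norm j y
  have h2 := (hF.riesz_mul j).coord_mul_inv_norm i y
  linear_combination (2 * Real.pi * Complex.I * (y i : ℂ) * ((‖y‖⁻¹ : ℝ) : ℂ)) * h1 +
    2 * Real.pi * h2

end IsSymbol

/-! ### The operators on the Fourier side and the explicit decomposition. -/

section

variable {n : ℕ}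

lemma isInvFourier_opK {u : VectorField n} {U : Fin n → Space n → ℂ}
    (h : ∀ i, IsInvFourier (fun x => u x i) (U i)) (i j k l : Fin n) :
    IsInvFourier (fun x => opK u x i j k l) (fun y =>
      (1 / 4 : ℝ) * (2 * Real.pi * Complex.I * (y i : ℂ) * U j y +
        2 * Real.pi * Complex.I * (y j : ℂ) * U i y) * (kron k l : ℝ) +
      (1 / 4 : ℝ) * (2 * Real.pi * Complex.I * (y l : ℂ) * U k y +
        2 * Real.pi * Complex.I * (y k : ℂ) * U l y) * (kron i j : ℝ)) :=
  (((((h j).pderiv i).add ((h i).pderiv j)).const_mul (1 / 4)).mul_const (kron k l)).add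
    (((((h k).pderiv l).add ((h l).pderiv k)).const_mul (1 / 4)).mul_const (kron i j))

lemma isInvFourier_opH {v : TensorField2 n} {V : Fin n → Fin n → Space n → ℂ}
    (h : ∀ i j, IsInvFourier (fun x => v x i j) (V i j)) (i j k l : Fin n) :
    IsInvFourier (fun x => opH v x i j k l) (fun y =>
      (1 / 2 : ℝ) * (2 * Real.pi * Complex.I * (y i : ℂ) *
        (2 * Real.pi * Complex.I * (y j : ℂ) * V k l y) +
        2 * Real.pi * Complex.I * (y k : ℂ) *
        (2 * Real.pi * Complex.I * (y l : ℂ) * V i j y))) :=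
  ((((h k l).pderiv j).pderiv i).add (((h i j).pderiv l).pderiv k)).const_mul (1 / 2)

lemma isInvFourier_opHstar {w : TensorField4 n} {W : Fin n → Fin n → Fin n → Fin n → Space n → ℂ}
    (h : ∀ i j k l, IsInvFourier (fun x => w x i j k l) (W i j k l)) (i j : Fin n) :
    IsInvFourier (fun x => opHstar w x i j) (fun y => ∑ k, ∑ l,
      2 * Real.pi * Complex.I * (y k : ℂ) *
        (2 * Real.pi * Complex.I * (y l : ℂ) * W i j k l y)) :=
  IsInvFourier.sum _ fun k _ => IsInvFourier.sum _ fun l _ => ((h i j k l).pderiv l).pderiv k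

lemma isInvFourier_opKstar {w : TensorField4 n} {W : Fin n → Fin n → Fin n → Fin n → Space n → ℂ}
    (h : ∀ i j k l, IsInvFourier (fun x => w x i j k l) (W i j k l)) (i : Fin n) :
    IsInvFourier (fun x => opKstar w x i) (fun y => -∑ k, ∑ j,
      2 * Real.pi * Complex.I * (y j : ℂ) * W i j k k y) :=
  (IsInvFourier.sum _ fun k _ => IsInvFourier.sum _ fun j _ => (h i j k k).pderiv j).neg

end

lemma coord_eq_norm_mul_riesz (i : Fin 2) (y : Space 2) :
    2 * Real.pi * Complex.I * (y i : ℂ) = 2 * Real.pi * (‖y‖ : ℂ) * riesz i y := by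
  linear_combination -(2 * Real.pi) * norm_mul_riesz i y

/-- Completeness of the orthogonal pair `ρ, ρ⊥`, each of square `-1`. It gives the frame coordinates
of the trace part of `K`. -/
lemma kron_eq_neg_frame {y : Space 2} (hy : y ≠ 0) (i j : Fin 2) :
    ((kron i j : ℝ) : ℂ) = -(frame 0 i j y + frame 2 i j y) := by
  have h := riesz_sq_add y hy
  fin_cases i <;> fin_cases j <;> simp [kron, frame, rieszPerp]
  · linear_combination h
  · ring
  · ring
  · linear_combination h

/-- The symbol of the solenoidal part. -/
noncomputable def solenoidalSymbol (W : Fin 2 → Fin 2 → Fin 2 → Fin 2 → Space 2 → ℂ)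
    (i j k l : Fin 2) (y : Space 2) : ℂ :=
  4 * (frame 1 i j y * (frame 1 k l y * frameCoeff W 1 1 y)) +
    frame 2 i j y * (frame 2 k l y * frameCoeff W 2 2 y)

/-- The vector potential of the potential part is the inverse Fourier transform of
`|y|⁻¹ * vectorSymbol`. -/
noncomputable def vectorSymbol (W : Fin 2 → Fin 2 → Fin 2 → Fin 2 → Space 2 → ℂ)
    (i : Fin 2) (y : Space 2) : ℂ :=
  (-(2 / Real.pi) : ℝ) * (rieszPerp i y * frameCoeff W 1 2 y)

/-- The tensor potential of the potential part is the inverse Fourier transform of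
`|y|⁻² * tensorSymbol`. -/
noncomputable def tensorSymbol (W : Fin 2 → Fin 2 → Fin 2 → Fin 2 → Space 2 → ℂ)
    (i j : Fin 2) (y : Space 2) : ℂ :=
  (1 / (2 * Real.pi ^ 2) : ℝ) * ((1 / 2 : ℝ) * (frame 0 i j y * frameCoeff W 0 0 y) +
    (2 : ℝ) * (frame 1 i j y * (frameCoeff W 0 1 y - frameCoeff W 1 2 y)) +
    frame 2 i j y * frameCoeff W 0 2 y)

section

variable {W : Fin 2 → Fin 2 → Fin 2 → Fin 2 → Space 2 → ℂ}

lemma isSymbol_solenoidalSymbol (hW : ∀ i j k l, IsSymbol (W i j k l)) (i j k l : Fin 2) :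
    IsSymbol (solenoidalSymbol W i j k l) := by
  have := ((((IsSymbol.frameCoeff hW 1 1).frame_mul 1 k l).frame_mul 1 i j).const_mul 4).add
    (((IsSymbol.frameCoeff hW 2 2).frame_mul 2 k l).frame_mul 2 i j)
  simpa using! this

lemma isSymbol_vectorSymbol (hW : ∀ i j k l, IsSymbol (W i j k l)) (i : Fin 2) :
    IsSymbol (vectorSymbol W i) :=
  ((IsSymbol.frameCoeff hW 1 2).rieszPerp_mul i).const_mul _

lemma isSymbol_tensorSymbol (hW : ∀ i j k l, IsSymbol (W i j k l)) (i j : Fin 2) :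
    IsSymbol (tensorSymbol W i j) :=
  (((((IsSymbol.frameCoeff hW 0 0).frame_mul 0 i j).const_mul _).add
    ((((IsSymbol.frameCoeff hW 0 1).sub (IsSymbol.frameCoeff hW 1 2)).frame_mul 1 i j).const_mul
      _)).add ((IsSymbol.frameCoeff hW 0 2).frame_mul 2 i j)).const_mul _

/-- Each surviving frame tensor contains a factor `ρ⊥`, which is orthogonal to `ρ`. -/
lemma sum_riesz_mul_solenoidalSymbol (i j : Fin 2) (y : Space 2) :
    ∑ k, ∑ l, riesz k y * riesz l y * solenoidalSymbol W i j k l y = 0 := by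
  simp [Fin.sum_univ_two, solenoidalSymbol, frame, rieszPerp]
  ring

/-- The trace kills the mixed tensor in the last pair, and contraction with `ρ` kills `ρ⊥ρ⊥` in the
first. -/
lemma sum_riesz_mul_solenoidalSymbol_trace (i : Fin 2) (y : Space 2) :
    ∑ k, ∑ j, riesz j y * solenoidalSymbol W i j k k y = 0 := by
  fin_cases i <;> simp [Fin.sum_univ_two, solenoidalSymbol, frame, rieszPerp] <;> ring

/-- The algebraic decomposition of an elastic tensor at a frequency `y ≠ 0`. -/
lemma symbol_decomposition {y : Space 2} (hy : y ≠ 0)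
    (h1 : ∀ i j k l, W i j k l y = W j i k l y) (h2 : ∀ i j k l, W i j k l y = W i j l k y)
    (h3 : ∀ i j k l, W i j k l y = W k l i j y) (i j k l : Fin 2) :
    W i j k l y - solenoidalSymbol W i j k l y =
      ((1 / 4 : ℝ) * (2 * Real.pi * (riesz i y * vectorSymbol W j y) +
        2 * Real.pi * (riesz j y * vectorSymbol W i y)) * (kron k l : ℝ) +
      (1 / 4 : ℝ) * (2 * Real.pi * (riesz l y * vectorSymbol W k y) +
        2 * Real.pi * (riesz k y * vectorSymbol W l y)) * (kron i j : ℝ)) +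
      (1 / 2 : ℝ) * (4 * Real.pi ^ 2 * (riesz i y * (riesz j y * tensorSymbol W k l y)) +
        4 * Real.pi ^ 2 * (riesz k y * (riesz l y * tensorSymbol W i j y))) := by
  have hc := frameCoeff_comm h3
  have hpi : (Real.pi : ℂ) ≠ 0 := by exact_mod_cast Real.pi_ne_zero
  -- After the factor `1/4` and `kron_eq_neg_frame`, this contributes `2 c₁₂` to the `(1,2)` entry
  -- as required, but also to the `(0,1)` entry; the difference `c₀₁ - c₁₂` in `tensorSymbol`
  -- removes the surplus.
  have hK : ∀ a b : Fin 2, 2 * Real.pi * (riesz a y * vectorSymbol W b y) +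
      2 * Real.pi * (riesz b y * vectorSymbol W a y) =
      -8 * frame 1 a b y * frameCoeff W 1 2 y := by
    intro a b
    simp only [vectorSymbol, frame]
    push_cast
    simp
    field_simp
    ring
  -- The factor `2` cancels the `1/2` in `H`. The `c₀₀` term carries its own `1/2` because
  -- symmetrization counts it twice.
  have hH : ∀ a b c d : Fin 2, 4 * Real.pi ^ 2 * (riesz a y * (riesz b y * tensorSymbol W c d y)) =
      2 * frame 0 a b y * ((1 / 2 : ℂ) * (frame 0 c d y * frameCoeff W 0 0 y) +
    2 * (frame 1 c d y * (frameCoeff W 0 1 y - frameCoeff W 1 2 y)) +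
    frame 2 c d y * frameCoeff W 0 2 y) := by
    intro a b c d
    have : frame 0 a b y = riesz a y * riesz b y := by simp [frame]
    rw [this, tensorSymbol]
    push_cast
    field_simp
    ring
  have hK' := hK k l
  rw [add_comm (2 * (Real.pi : ℂ) * (riesz k y * vectorSymbol W l y))] at hK'
  rw [eq_sum_frameCoeff hy W h1 h2 i j k l, hK i j, hK', hH, hH, kron_eq_neg_frame hy,
    kron_eq_neg_frame hy, solenoidalSymbol]
  simp only [Fin.sum_univ_three, hc 1 0, hc 2 0, hc 2 1]
  push_cast
  simp
  ring

end

/-! ### Compatibility conditions for potential fields. -/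

lemma contDiff_pderiv {n : ℕ} {f : Space n → ℝ} (hf : ContDiff ℝ ∞ f) (i : Fin n) :
    ContDiff ℝ ∞ (pderiv i f) :=
  (hf.fderiv_right (m := ∞) le_rfl).clm_apply contDiff_const

/-- The space of smooth functions on `ℝⁿ`. -/
def smoothFunctions (n : ℕ) : Submodule ℝ (Space n → ℝ) where
  carrier := {f | ContDiff ℝ ∞ f}
  add_mem' {f g} hf hg := by
    rw [Set.mem_ofPred_eq] at *
    exact hf.add hg
  zero_mem' := by
    rw [Set.mem_ofPred_eq]
    exact contDiff_const
  smul_mem' c f hf := by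
    rw [Set.mem_ofPred_eq] at *
    exact contDiff_const.smul hf

lemma mem_smoothFunctions {n : ℕ} {f : Space n → ℝ} :
    f ∈ smoothFunctions n ↔ ContDiff ℝ ∞ f := Iff.rfl

lemma contDiff_coe {n : ℕ} (f : smoothFunctions n) : ContDiff ℝ ∞ (f : Space n → ℝ) :=
  mem_smoothFunctions.1 f.2

/-- The partial derivative as an endomorphism of the space of smooth functions. -/
noncomputable def smoothDeriv {n : ℕ} (i : Fin n) : smoothFunctions n →ₗ[ℝ] smoothFunctions n where
  toFun f := ⟨pderiv i f, mem_smoothFunctions.2 (contDiff_pderiv (contDiff_coe f) i)⟩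
  map_add' f g := by
    ext x
    have hf : DifferentiableAt ℝ (f : Space n → ℝ) x :=
      (contDiff_coe f).differentiable (by simp) x
    have hg : DifferentiableAt ℝ (g : Space n → ℝ) x :=
      (contDiff_coe g).differentiable (by simp) x
    simp [pderiv, fderiv_add hf hg]
  map_smul' c f := by
    ext x
    have hf : DifferentiableAt ℝ (f : Space n → ℝ) x :=
      (contDiff_coe f).differentiable (by simp) x
    simp [pderiv, fderiv_const_smul hf]

lemma smoothDeriv_comm {n : ℕ} (i j : Fin n) (f : smoothFunctions n) :
    smoothDeriv i (smoothDeriv j f) = smoothDeriv j (smoothDeriv i f) :=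
  Subtype.ext (funext fun x => pderiv_comm (contDiff_coe f) i j x)

/-- The rotation by a quarter turn of the gradient. -/
noncomputable def smoothDerivPerp (i : Fin 2) : smoothFunctions 2 →ₗ[ℝ] smoothFunctions 2 :=
  ![-smoothDeriv 1, smoothDeriv 0] i

lemma isInvFourier_smoothDeriv {f : smoothFunctions 2} {F : Space 2 → ℂ}
    (h : IsInvFourier (f : Space 2 → ℝ) F) (i : Fin 2) :
    IsInvFourier (smoothDeriv i f : Space 2 → ℝ)
      (fun y => 2 * Real.pi * (‖y‖ : ℂ) * riesz i y * F y) :=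
  (h.pderiv i).congr (fun _ => rfl) fun y => by rw [coord_eq_norm_mul_riesz]

lemma isInvFourier_smoothDerivPerp {f : smoothFunctions 2} {F : Space 2 → ℂ}
    (h : IsInvFourier (f : Space 2 → ℝ) F) (i : Fin 2) :
    IsInvFourier (smoothDerivPerp i f : Space 2 → ℝ)
      (fun y => 2 * Real.pi * (‖y‖ : ℂ) * rieszPerp i y * F y) := by
  fin_cases i
  · refine (isInvFourier_smoothDeriv h 1).neg.congr (fun _ => rfl) fun y => ?_
    simp [rieszPerp]
  · exact isInvFourier_smoothDeriv h 0

/-- The potential tensor field of the potentials `u` and `v`, as a tensor of smooth functions. -/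
noncomputable def smoothPotential (u : Fin 2 → smoothFunctions 2)
    (v : Fin 2 → Fin 2 → smoothFunctions 2) (i j k l : Fin 2) : smoothFunctions 2 :=
  (1 / 4 * kron k l : ℝ) • (smoothDeriv i (u j) + smoothDeriv j (u i)) +
    (1 / 4 * kron i j : ℝ) • (smoothDeriv l (u k) + smoothDeriv k (u l)) +
    (1 / 2 : ℝ) • (smoothDeriv i (smoothDeriv j (v k l)) + smoothDeriv k (smoothDeriv l (v i j)))

section compatibility

variable (u : Fin 2 → smoothFunctions 2) (v : Fin 2 → Fin 2 → smoothFunctions 2)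

/-- Each term of a potential has a derivative index, and contracting it with the rotated gradient
gives zero since partial derivatives commute. As linear endomorphisms of the smooth functions, the
derivatives make this a module identity, with no growth condition on `u` or `v`. -/
lemma sum_perp_perp_smoothPotential :
    ∑ i, ∑ j, ∑ k, ∑ l, smoothDerivPerp i (smoothDerivPerp j (smoothDerivPerp k (smoothDerivPerp l
      (smoothPotential u v i j k l)))) = 0 := by
  simp only [Fin.sum_univ_two, smoothDerivPerp, smoothPotential, kron, Matrix.cons_val_zero,
    Matrix.cons_val_one, LinearMap.neg_apply, map_add, map_smul, map_neg, smoothDeriv_comm 1 0]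
  simp
  module

/-- Here the `δ` in `K` is contracted with a gradient and a rotated gradient, and the Hessian in `H`
with a rotated gradient; both give zero. -/
lemma sum_deriv_perp_smoothPotential (hv : v 0 1 = v 1 0) :
    ∑ i, ∑ j, ∑ k, ∑ l, smoothDeriv i (smoothDerivPerp j (smoothDeriv k (smoothDerivPerp l
      (smoothPotential u v i j k l)))) = 0 := by
  simp only [Fin.sum_univ_two, smoothDerivPerp, smoothPotential, kron, Matrix.cons_val_zero,
    Matrix.cons_val_one, LinearMap.neg_apply, map_add, map_smul, map_neg, smoothDeriv_comm 1 0, hv]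
  simp
  module

end compatibility

lemma isInvFourier_coe_sum {ι : Type*} (s : Finset ι) {f : ι → smoothFunctions 2}
    {F : ι → Space 2 → ℂ} (h : ∀ i, IsInvFourier (f i : Space 2 → ℝ) (F i)) :
    IsInvFourier ((∑ i ∈ s, f i : smoothFunctions 2) : Space 2 → ℝ) (fun y => ∑ i ∈ s, F i y) :=
  (IsInvFourier.sum s fun i _ => h i).congr (fun x => by simp) fun _ => rfl

/-- The components of the Fourier transform of a potential field that vanish. -/
lemma frameCoeff_eq_zero_of_potential {h : TensorField4 2}
    {W : Fin 2 → Fin 2 → Fin 2 → Fin 2 → Space 2 → ℂ}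
    (hW : ∀ i j k l, IsInvFourier (fun x => h x i j k l) (W i j k l))
    (h1 : ∀ i j k l, W i j k l = W j i k l) (h2 : ∀ i j k l, W i j k l = W i j l k)
    {u : VectorField 2} {v : TensorField2 2} (hu : ∀ i, ContDiff ℝ ∞ (fun x => u x i))
    (hv : ∀ i j, ContDiff ℝ ∞ (fun x => v x i j)) (he : IsElastic1 v)
    (hp : ∀ x, h x = opK u x + opH v x) :
    ∀ᵐ y, frameCoeff W 1 1 y = 0 ∧ frameCoeff W 2 2 y = 0 := by
  let us : Fin 2 → smoothFunctions 2 := fun i => ⟨fun x => u x i, mem_smoothFunctions.2 (hu i)⟩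
  let vs : Fin 2 → Fin 2 → smoothFunctions 2 := fun i j => ⟨fun x => v x i j, mem_smoothFunctions.2 (hv i j)⟩
  have hs : ∀ i j k l, IsInvFourier (smoothPotential us vs i j k l : Space 2 → ℝ)
      (W i j k l) := fun i j k l => (hW i j k l).congr (fun x => by
    rw [hp x]
    change opK u x i j k l + opH v x i j k l = (1 / 4 * kron k l) *
      (pderiv i (fun z => u z j) x + pderiv j (fun z => u z i) x) +
      (1 / 4 * kron i j) * (pderiv l (fun z => u z k) x + pderiv k (fun z => u z l) x) +
      (1 / 2) * (pderiv i (pderiv j (fun z => v z k l)) x +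
        pderiv k (pderiv l (fun z => v z i j)) x)
    rw [opK, opH]
    ring) fun _ => rfl
  have hvs : vs 0 1 = vs 1 0 := Subtype.ext (funext fun x => he x 0 1)
  have e1 := isInvFourier_coe_sum Finset.univ fun i => isInvFourier_coe_sum Finset.univ fun j =>
    isInvFourier_coe_sum Finset.univ fun k => isInvFourier_coe_sum Finset.univ fun l =>
      isInvFourier_smoothDeriv (isInvFourier_smoothDerivPerp (isInvFourier_smoothDeriv
        (isInvFourier_smoothDerivPerp (hs i j k l) l) k) j) i
  have e2 := isInvFourier_coe_sum Finset.univ fun i => isInvFourier_coe_sum Finset.univ fun j =>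
    isInvFourier_coe_sum Finset.univ fun k => isInvFourier_coe_sum Finset.univ fun l =>
      isInvFourier_smoothDerivPerp (isInvFourier_smoothDerivPerp (isInvFourier_smoothDerivPerp
        (isInvFourier_smoothDerivPerp (hs i j k l) l) k) j) i
  rw [sum_deriv_perp_smoothPotential us vs hvs] at e1
  rw [sum_perp_perp_smoothPotential us vs] at e2
  filter_upwards [e1.ae_eq_zero fun _ => rfl, e2.ae_eq_zero fun _ => rfl,
    Measure.ae_ne volume (0 : Space 2)] with y hy1 hy2 hy
  -- Each of the four derivatives contributes `2π|y|`.
  have hn : (2 * Real.pi * (‖y‖ : ℂ)) ^ 4 ≠ 0 := by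
    have : (‖y‖ : ℂ) ≠ 0 := by exact_mod_cast norm_ne_zero_iff.2 hy
    have hpi : (Real.pi : ℂ) ≠ 0 := by exact_mod_cast Real.pi_ne_zero
    exact pow_ne_zero 4 (mul_ne_zero (mul_ne_zero two_ne_zero hpi) this)
  constructor
  · apply mul_left_cancel₀ hn
    rw [mul_zero, ← hy1]
    simp only [frameCoeff, frame, Fin.sum_univ_two, h1 1 0, h2 _ _ 1 0]
    simp
    ring
  · apply mul_left_cancel₀ hn
    rw [mul_zero, ← hy2]
    simp only [frameCoeff, frame, Fin.sum_univ_two]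
    simp
    ring

/-! ### Coefficients of solenoidal fields, uniqueness and existence. -/

/-- The components of the Fourier transform of a solenoidal field that vanish. -/
lemma frameCoeff_eq_zero_of_solenoidal {g : TensorField4 2}
    {W : Fin 2 → Fin 2 → Fin 2 → Fin 2 → Space 2 → ℂ}
    (hW : ∀ i j k l, IsInvFourier (fun x => g x i j k l) (W i j k l))
    (h1 : ∀ i j k l, W i j k l = W j i k l)
    (hH : ∀ x, opHstar g x = 0) (hK : ∀ x, opKstar g x = 0) :
    ∀ᵐ y, (∀ p, frameCoeff W p 0 y = 0) ∧ frameCoeff W 1 2 y = 0 := by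
  have e1 : ∀ᵐ y, ∀ i j, ∑ k, ∑ l, 2 * Real.pi * Complex.I * (y k : ℂ) *
      (2 * Real.pi * Complex.I * (y l : ℂ) * W i j k l y) = 0 :=
    ae_all_iff.2 fun i => ae_all_iff.2 fun j => (isInvFourier_opHstar hW i j).ae_eq_zero
      fun x => by rw [hH x]; rfl
  have e2 : ∀ᵐ y, ∀ i, -∑ k, ∑ j, 2 * Real.pi * Complex.I * (y j : ℂ) * W i j k k y = 0 :=
    ae_all_iff.2 fun i => (isInvFourier_opKstar hW i).ae_eq_zero fun x => by rw [hK x]; rfl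
  filter_upwards [e1, e2, Measure.ae_ne volume (0 : Space 2)] with y hy1 hy2 hy
  have hn : 2 * Real.pi * (‖y‖ : ℂ) ≠ 0 := by
    have : (‖y‖ : ℂ) ≠ 0 := by exact_mod_cast norm_ne_zero_iff.2 hy
    have hpi : (Real.pi : ℂ) ≠ 0 := by exact_mod_cast Real.pi_ne_zero
    exact mul_ne_zero (mul_ne_zero two_ne_zero hpi) this
  have f1 : ∀ p, frameCoeff W p 0 y = 0 := by
    intro p
    refine Finset.sum_eq_zero fun i _ => Finset.sum_eq_zero fun j _ => ?_
    rw [mul_eq_zero]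
    right
    apply mul_left_cancel₀ (pow_ne_zero 2 hn)
    rw [mul_zero, ← hy1 i j]
    simp only [coord_eq_norm_mul_riesz, Fin.sum_univ_two, frame]
    simp
    ring
  refine ⟨f1, ?_⟩
  have f2 : ∀ i, ∑ k, ∑ j, riesz j y * W i j k k y = 0 := by
    intro i
    apply mul_left_cancel₀ hn
    rw [mul_zero, ← neg_eq_zero.1 (hy2 i)]
    simp only [coord_eq_norm_mul_riesz, Fin.sum_univ_two]
    ring
  -- The `ρ⊥` component of `K*`: its trace is minus the sum of the `0` and `2` frame directions, and
  -- the `0` direction is already killed by `H*`.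
  have f3 : ∑ i, rieszPerp i y * ∑ k, ∑ j, riesz j y * W i j k k y =
      -(frameCoeff W 1 0 y + frameCoeff W 1 2 y) := by
    have : -(frameCoeff W 1 0 y + frameCoeff W 1 2 y) =
        ∑ i, ∑ j, frame 1 i j y * ∑ k, ∑ l, ((kron k l : ℝ) : ℂ) * W i j k l y := by
      simp only [kron_eq_neg_frame hy, frameCoeff, Fin.sum_univ_two]
      ring
    rw [this]
    simp only [Fin.sum_univ_two, frame, kron, h1 1 0]
    simp
    ring
  simp only [f2, f1, mul_zero, Finset.sum_const_zero, zero_add] at f3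
  exact neg_eq_zero.1 f3.symm

lemma MemA2.exists_isInvFourier {w : TensorField4 2} (hw : MemA2 w) :
    ∃ W : Fin 2 → Fin 2 → Fin 2 → Fin 2 → Space 2 → ℂ,
      (∀ i j k l, IsInvFourier (fun x => w x i j k l) (W i j k l)) ∧
      (∀ i j k l, W i j k l = W j i k l) ∧ (∀ i j k l, W i j k l = W i j l k) ∧
      (∀ i j k l, W i j k l = W k l i j) := by
  have h : ∀ φ : Space 2 → ℝ, HasNiceFourier φ ∧ Continuous φ → ∃ F, IsInvFourier φ F :=
    fun φ hφ => hφ.1.exists_isInvFourier hφ.2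
  -- The transform is chosen as a function of `φ`, so that equal components get the same
  -- representative and the symmetries hold everywhere, not just almost everywhere.
  choose! T hT using h
  refine ⟨fun i j k l => T fun x => w x i j k l, fun i j k l =>
    hT _ ⟨hw.fourier i j k l, (hw.smooth i j k l).continuous⟩, fun i j k l => ?_,
    fun i j k l => ?_, fun i j k l => ?_⟩
  · exact congrArg T (funext fun x => (hw.elastic x i j k l).1)
  · exact congrArg T (funext fun x => (hw.elastic x i j k l).2.1)
  · exact congrArg T (funext fun x => (hw.elastic x i j k l).2.2)

lemma exists_isSymbol_of_isSchwartzElastic2 {f : TensorField4 2} (hf : IsSchwartzElastic2 f)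
    (hmean : ∀ i j k l, (∫ x, f x i j k l) = 0) :
    ∃ W : Fin 2 → Fin 2 → Fin 2 → Fin 2 → Space 2 → ℂ,
      (∀ i j k l, IsInvFourier (fun x => f x i j k l) (W i j k l)) ∧
      (∀ i j k l, IsSymbol (W i j k l)) ∧
      (∀ i j k l, W i j k l = W j i k l) ∧ (∀ i j k l, W i j k l = W i j l k) ∧
      (∀ i j k l, W i j k l = W k l i j) := by
  have h : ∀ φ : Space 2 → ℝ, ((∃ ψ : 𝓢(Space 2, ℝ), ∀ x, ψ x = φ x) ∧ ∫ x, φ x = 0) →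
      ∃ F, IsInvFourier φ F ∧ IsSymbol F := by
    rintro φ ⟨⟨ψ, hψ⟩, h0⟩
    obtain rfl : ⇑ψ = φ := funext hψ
    exact exists_isSymbol_of_schwartz ψ h0
  choose! T hT using h
  have hT' := fun i j k l => hT (fun x => f x i j k l) ⟨hf.2 i j k l, hmean i j k l⟩
  refine ⟨fun i j k l => T fun x => f x i j k l, fun i j k l => (hT' i j k l).1,
    fun i j k l => (hT' i j k l).2, fun i j k l => ?_, fun i j k l => ?_, fun i j k l => ?_⟩
  · exact congrArg T (funext fun x => (hf.1 x i j k l).1)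
  · exact congrArg T (funext fun x => (hf.1 x i j k l).2.1)
  · exact congrArg T (funext fun x => (hf.1 x i j k l).2.2)

/-- A decomposition of `f` into a potential and a solenoidal part. -/
def IsDecomposition (f h g : TensorField4 2) : Prop :=
  MemA2 h ∧ MemA2 g ∧ (∀ x, f x = h x + g x) ∧ (∀ x, opHstar g x = 0) ∧ (∀ x, opKstar g x = 0) ∧
    ∃ (u : VectorField 2) (v : TensorField2 2), MemA0K u ∧ MemA1H v ∧
      ∀ x, h x = opK u x + opH v x

lemma IsDecomposition.unique {f h g h' g' : TensorField4 2} (hd : IsDecomposition f h g)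
    (hd' : IsDecomposition f h' g') : h = h' ∧ g = g' := by
  obtain ⟨ha, ga, hs, gH, gK, u, v, hu, hv, hp⟩ := hd
  obtain ⟨ha', ga', hs', gH', gK', u', v', hu', hv', hp'⟩ := hd'
  obtain ⟨A, hA, hA1, hA2, -⟩ := ha.exists_isInvFourier
  obtain ⟨A', hA', hA1', hA2', -⟩ := ha'.exists_isInvFourier
  obtain ⟨B, hB, hB1, hB2, hB3⟩ := ga.exists_isInvFourier
  obtain ⟨B', hB', hB1', hB2', hB3'⟩ := ga'.exists_isInvFourier
  have hAB : ∀ᵐ y, ∀ i j k l, B i j k l y - B' i j k l y = A' i j k l y - A i j k l y := by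
    refine ae_all_iff.2 fun i => ae_all_iff.2 fun j => ae_all_iff.2 fun k => ae_all_iff.2 fun l => ?_
    refine ((hB i j k l).sub (hB' i j k l)).ae_eq
      (((hA' i j k l).sub (hA i j k l)).congr (fun x => ?_) fun _ => rfl)
    have e := (hs x).symm.trans (hs' x)
    have := congrFun (congrFun (congrFun (congrFun e i) j) k) l
    simp only [Pi.add_apply] at this
    linarith
  have hBB : ∀ᵐ y, ∀ i j k l, B i j k l y = B' i j k l y := by
    filter_upwards [hAB, frameCoeff_eq_zero_of_potential hA hA1 hA2 hu.smooth hv.smooth hv.elastic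
      hp, frameCoeff_eq_zero_of_potential hA' hA1' hA2' hu'.smooth hv'.smooth hv'.elastic hp',
      frameCoeff_eq_zero_of_solenoidal hB hB1 gH gK,
      frameCoeff_eq_zero_of_solenoidal hB' hB1' gH' gK',
      Measure.ae_ne volume (0 : Space 2)] with y hy hpy hpy' hgy hgy' hy0 i j k l
    have hB3y : ∀ i j k l, B i j k l y = B k l i j y := fun i j k l => by rw [hB3]
    have hB3y' : ∀ i j k l, B' i j k l y = B' k l i j y := fun i j k l => by rw [hB3']
    -- This transfers the vanishing of `c₁₁` and `c₂₂` from the potential parts to the difference of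
    -- the solenoidal parts; the other entries vanish by solenoidality.
    have hc : ∀ p q, frameCoeff B p q y - frameCoeff B' p q y =
        frameCoeff A' p q y - frameCoeff A p q y := by
      intro p q
      rw [← frameCoeff_sub, ← frameCoeff_sub]
      simp only [frameCoeff, hy]
    have h0 : ∀ p q, frameCoeff (fun i j k l y => B i j k l y - B' i j k l y) p q y = 0 := by
      intro p q
      rw [frameCoeff_sub]
      fin_cases p <;> fin_cases q <;> simp only [Fin.zero_eta, Fin.mk_one, Fin.reduceFinMk]
      · rw [hgy.1, hgy'.1, sub_zero]
      · rw [frameCoeff_comm hB3y, frameCoeff_comm hB3y', hgy.1, hgy'.1, sub_zero]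
      · rw [frameCoeff_comm hB3y, frameCoeff_comm hB3y', hgy.1, hgy'.1, sub_zero]
      · rw [hgy.1, hgy'.1, sub_zero]
      · rw [hc, hpy.1, hpy'.1, sub_zero]
      · rw [hgy.2, hgy'.2, sub_zero]
      · rw [hgy.1, hgy'.1, sub_zero]
      · rw [frameCoeff_comm hB3y, frameCoeff_comm hB3y', hgy.2, hgy'.2, sub_zero]
      · rw [hc, hpy.2, hpy'.2, sub_zero]
    have := eq_sum_frameCoeff hy0 (fun i j k l y => B i j k l y - B' i j k l y)
      (fun i j k l => by rw [hB1, hB1']) (fun i j k l => by rw [hB2, hB2']) i j k l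
    simp only [h0, mul_zero, Finset.sum_const_zero] at this
    exact sub_eq_zero.1 this
  have hg : g = g' := by
    funext x i j k l
    exact (hB i j k l).ext (hB' i j k l) (by filter_upwards [hBB] with y hy using hy i j k l) x
  refine ⟨funext fun x => ?_, hg⟩
  have e := (hs x).symm.trans (hs' x)
  rw [hg] at e
  exact add_right_cancel e

lemma exists_isDecomposition {f : TensorField4 2} (hf : IsSchwartzElastic2 f)
    (hmean : ∀ i j k l, (∫ x, f x i j k l) = 0) : ∃ h g, IsDecomposition f h g := by
  obtain ⟨W, hW, hS, h1, h2, h3⟩ := exists_isSymbol_of_isSchwartzElastic2 hf hmean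
  have hGs := isSymbol_solenoidalSymbol hS
  have hUs := isSymbol_vectorSymbol hS
  have hVs := isSymbol_tensorSymbol hS
  set G := solenoidalSymbol W with hG
  let g : TensorField4 2 := fun x i j k l => (𝓕⁻ (G i j k l) x).re
  have hg : ∀ i j k l, IsInvFourier (fun x => g x i j k l) (G i j k l) := fun i j k l =>
    (hGs i j k l).hasMoments.isInvFourier_re (hGs i j k l).hermitian
  let u : VectorField 2 := fun x i =>
    (𝓕⁻ (fun y => ((‖y‖⁻¹ : ℝ) : ℂ) * vectorSymbol W i y) x).re
  have hu : ∀ i, IsInvFourier (fun x => u x i)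
      (fun y => ((‖y‖⁻¹ : ℝ) : ℂ) * vectorSymbol W i y) := fun i =>
    (hUs i).hasMoments_inv_norm.isInvFourier_re fun y => by
      simp [(hUs i).hermitian]
  let v : TensorField2 2 := fun x i j =>
    (𝓕⁻ (fun y => ((‖y‖⁻¹ : ℝ) : ℂ) ^ 2 * tensorSymbol W i j y) x).re
  have hv : ∀ i j, IsInvFourier (fun x => v x i j)
      (fun y => ((‖y‖⁻¹ : ℝ) : ℂ) ^ 2 * tensorSymbol W i j y) := fun i j =>
    (hVs i j).hasMoments_inv_norm_sq.isInvFourier_re fun y => by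
      simp [(hVs i j).hermitian]
  have hGe : ∀ i j k l, G i j k l = G j i k l ∧ G i j k l = G i j l k ∧ G i j k l = G k l i j := by
    intro i j k l
    refine ⟨funext fun y => ?_, funext fun y => ?_, funext fun y => ?_⟩ <;>
      simp only [hG, solenoidalSymbol]
    · rw [frame_comm 1 i j, frame_comm 2 i j]
    · rw [frame_comm 1 k l, frame_comm 2 k l]
    · ring
  have hge : IsElastic2 g := fun x i j k l => by
    refine ⟨?_, ?_, ?_⟩ <;> simp only [g]
    · rw [(hGe i j k l).1]
    · rw [(hGe i j k l).2.1]
    · rw [(hGe i j k l).2.2]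
  have hve : IsElastic1 v := fun x i j => by
    have : tensorSymbol W i j = tensorSymbol W j i := funext fun y => by
      simp only [tensorSymbol, frame_comm _ i j]
    simp only [v, this]
  have hvs : ∀ i j, ContDiff ℝ ∞ (fun x => v x i j) := fun i j => (hv i j).contDiff
  -- The negative powers of `|y|` cancel against the derivatives, so the images of the potentials
  -- have genuine symbols although the potentials do not.
  have hK := fun i j k l => (isInvFourier_opK hu i j k l).congr (fun _ => rfl) fun y => by
    rw [(hUs j).coord_mul_inv_norm, (hUs i).coord_mul_inv_norm, (hUs k).coord_mul_inv_norm,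
      (hUs l).coord_mul_inv_norm]
  have hH := fun i j k l => (isInvFourier_opH hv i j k l).congr (fun _ => rfl) fun y => by
    rw [(hVs k l).coord_mul_coord_mul_inv_norm_sq, (hVs i j).coord_mul_coord_mul_inv_norm_sq]
  have hKA : MemA2 (opK u) := MemA2.of_isSymbol (isElastic2_opK u) hK fun i j k l => by
    have hr : ∀ a b, IsSymbol (fun y => 2 * Real.pi * (riesz a y * vectorSymbol W b y)) :=
      fun a b => by simpa using ((hUs b).riesz_mul a).const_mul (2 * Real.pi)
    exact ((((hr i j).add (hr j i)).const_mul _).mul_const _).add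
      ((((hr l k).add (hr k l)).const_mul _).mul_const _)
  have hHA : MemA2 (opH v) := MemA2.of_isSymbol (isElastic2_opH hve hvs) hH fun i j k l => by
    have hr : ∀ a b c d, IsSymbol
        (fun y => 4 * Real.pi ^ 2 * (riesz a y * (riesz b y * tensorSymbol W c d y))) :=
      fun a b c d => by
        have := (((hVs c d).riesz_mul b).riesz_mul a).const_mul (4 * Real.pi ^ 2)
        push_cast at this
        exact this
    exact ((hr i j k l).add (hr k l i j)).const_mul _
  refine ⟨fun x i j k l => f x i j k l - g x i j k l, g,
    MemA2.of_isSymbol (fun x i j k l => ?_) (fun i j k l => (hW i j k l).sub (hg i j k l))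
      fun i j k l => (hS i j k l).sub (hGs i j k l),
    MemA2.of_isSymbol hge hg hGs, fun x => ?_, fun x => ?_, fun x => ?_,
    u, v, ⟨fun i => (hu i).contDiff, hKA⟩, ⟨hve, hvs, hHA⟩, fun x => ?_⟩
  · have hfx := hf.1 x i j k l
    have hgx := hge x i j k l
    exact ⟨by rw [hfx.1, hgx.1], by rw [hfx.2.1, hgx.2.1], by rw [hfx.2.2, hgx.2.2]⟩
  · funext i j k l
    simp
  · funext i j
    refine (isInvFourier_opHstar hg i j).ext IsInvFourier.zero
      (Filter.Eventually.of_forall fun y => ?_) x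
    have := sum_riesz_mul_solenoidalSymbol (W := W) i j y
    simp only [coord_eq_norm_mul_riesz, Fin.sum_univ_two] at this ⊢
    linear_combination (2 * Real.pi * (‖y‖ : ℂ)) ^ 2 * this
  · funext i
    refine (isInvFourier_opKstar hg i).ext IsInvFourier.zero
      (Filter.Eventually.of_forall fun y => ?_) x
    have := sum_riesz_mul_solenoidalSymbol_trace (W := W) i y
    simp only [coord_eq_norm_mul_riesz, Fin.sum_univ_two] at this ⊢
    linear_combination -(2 * Real.pi * (‖y‖ : ℂ)) * this
  · funext i j k l
    refine ((hW i j k l).sub (hg i j k l)).ext ((hK i j k l).add (hH i j k l)) ?_ x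
    filter_upwards [Measure.ae_ne volume (0 : Space 2)] with y hy
    exact symbol_decomposition hy (fun i j k l => by rw [h1]) (fun i j k l => by rw [h2])
      (fun i j k l => by rw [h3]) i j k l

end ElasticTensor

theorem mainTheorem8 (f : ElasticTensor.TensorField4 2)
    (hf : ElasticTensor.IsSchwartzElastic2 f)
    (hmean : ∀ i j k l, (∫ x, f x i j k l) = 0) :
    ∃! p : ElasticTensor.TensorField4 2 × ElasticTensor.TensorField4 2,
      ElasticTensor.MemA2 p.1 ∧ ElasticTensor.MemA2 p.2 ∧
      (∀ x, f x = p.1 x + p.2 x) ∧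
      (∀ x, ElasticTensor.opHstar p.2 x = 0) ∧
      (∀ x, ElasticTensor.opKstar p.2 x = 0) ∧
      ∃ (u : ElasticTensor.VectorField 2) (v : ElasticTensor.TensorField2 2),
        ElasticTensor.MemA0K u ∧ ElasticTensor.MemA1H v ∧
        ∀ x, p.1 x = ElasticTensor.opK u x + ElasticTensor.opH v x := by
  obtain ⟨h, g, hd⟩ := ElasticTensor.exists_isDecomposition hf hmean
  refine ⟨(h, g), hd, fun p hp => ?_⟩
  obtain ⟨e1, e2⟩ := ElasticTensor.IsDecomposition.unique hp hd
  exact Prod.ext e1 e2
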